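/- Consider a Markov decision process with finite state space $\mathcal S$, finite action space $\mathcal A$, transition probabilities $P_a(s,s')$, reward function $\mathcal R:\mathcal S\times\mathcal A\to[0,1]$ and discount factor $\gamma\in(0,1)$. Let $\pi$ be a policy such that the state chain $\mathcal M_S$ it induces, with transition matrix $P_\pi(s,s')=\sum_a\pi(a|s)P_a(s,s')$, is irreducible and aperiodic. Let $\kappa$ be its stationary distribution, $\mathcal K_{\min}=\min_s\kappa(s)$, and $V_\pi(s)=\mathbb E_\pi[\sum_{k\ge0}\gamma^k\mathcal R(S_k,A_k)\mid S_0=s]$. For $\delta\in(0,1)$ let $t_\delta=\min\{k\ge0:\max_s\|P_\pi^k(s,\cdot)-\kappa\|_{\mathrm{TV}}\le\delta\}$ be the mixing time of $\mathcal M_S$. For an integer $n\ge1$, the on-policy $n$-step TD algorithm with constant stepsize $\alpha$ and initial vector $V_0\in\mathbb R^{|\mathcal S|}$, run along one trajectory $S_0,A_0,S_1,A_1,\dots$ generated by $\pi$, is $$V_{k+1}(S_k)=V_k(S_k)+\alpha\Big(\sum_{i=0}^{n-1}\gamma^i\mathcal R(S_{k+i},A_{k+i})+\gamma^nV_k(S_{k+n})-V_k(S_k)\Big),\qquad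 V_{k+1}(s)=V_k(s)\ \text{ for } s\ne S_k .$$ (The iterate $V_k$ uses the states $S_0,\dots,S_{k+n-1}$.) For $x\ge1$ and $p\in\mathbb N$ write $\tilde O_p(x)=x\,(1+\log x)^p$. There are numerical constants $c>0$ and $p\in\mathbb N$ such that, for every such MDP and policy, the following holds. (i) There is a finite $L$ with $t_\delta\le L(\log(1/\delta)+1)$ for all $\delta\in(0,1)$. (ii) For every such $L$, every $n\ge1$ and every accuracy $\epsilon\in(0,1/2]$ there is a constant stepsize $\alpha\in(0,1)$ such that, for every distribution of $S_0$, every $V_0$ and every $k\ge 0$ whose number of samples $k+n$ is at least $$c\,\frac{\log^2(1/\epsilon)}{\epsilon^2}\;\tilde O_p\!\Big(\frac1{(1-\gamma)^2}\Big)\,\tilde O_p\!\Big(\frac n{(1-\gamma^n)^2}\Big)\,\tilde O_p\big(\mathcal K_{\min}^{-2}\big)\,\tilde O_p\big(|\mathcal S|^{1/2}\big)\,\tilde O_p(1+L)\,\big(1+\log(1+\|V_0\|_2)\big)^p ,$$ the random variable $\|V_k-V_\pi\|_2$ is integrable and $\mathbb E[\|V_k-V_\pi\|_2]\le\epsilon$.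 -/

import Mathlib

open MeasureTheory ProbabilityTheory

noncomputable section

/-- A Markov decision process with state space `S`, action space `A`, transition probabilities
`P s a` (the law of the next state), rewards in `[0,1]` and discount factor `γ ∈ (0,1)`. -/
structure MDP (S A : Type*) where
  P : S → A → PMF S
  R : S → A → ℝ
  R_mem : ∀ s a, R s a ∈ Set.Icc (0 : ℝ) 1
  γ : ℝ
  γ_pos : 0 < γ
  γ_lt_one : γ < 1

namespace MDP

variable {S A : Type*}

/-- One step of the state chain induced by the (stationary, randomized) policy `π`. -/
def step (M : MDP S A) (π : S → PMF A) (s : S) : PMF S :=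
  (π s).bind fun a => M.P s a

/-- The transition matrix `P_π` of the state chain induced by `π`. -/
def transMatrix (M : MDP S A) (π : S → PMF A) : Matrix S S ℝ :=
  Matrix.of fun s s' => (M.step π s s').toReal

/-- The law of a state-action pair `(s, a)` with `s ∼ ν` and `a ∼ π s`. -/
def withAction (π : S → PMF A) (ν : PMF S) : PMF (S × A) :=
  ν.bind fun s => (π s).map (Prod.mk s)

/-- The transition kernel of the state-action chain: `s' ∼ P s a`, then `a' ∼ π s'`. -/
def stepKernel [Countable S] [MeasurableSpace S] [DiscreteMeasurableSpace S]
    [Countable A] [MeasurableSpace A] [DiscreteMeasurableSpace A]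
    (M : MDP S A) (π : S → PMF A) : Kernel (S × A) (S × A) :=
  Kernel.ofFunOfCountable fun x => (withAction π (M.P x.1 x.2)).toMeasure

instance [Countable S] [MeasurableSpace S] [DiscreteMeasurableSpace S]
    [Countable A] [MeasurableSpace A] [DiscreteMeasurableSpace A]
    (M : MDP S A) (π : S → PMF A) : IsMarkovKernel (M.stepKernel π) :=
  ⟨fun x => inferInstanceAs (IsProbabilityMeasure (withAction π (M.P x.1 x.2)).toMeasure)⟩

/-- The law of the trajectory `(S_0, A_0), (S_1, A_1), …` generated by `π` when `S_0 ∼ ν`. -/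
def pathMeasure [Countable S] [MeasurableSpace S] [DiscreteMeasurableSpace S]
    [Countable A] [MeasurableSpace A] [DiscreteMeasurableSpace A]
    (M : MDP S A) (π : S → PMF A) (ν : PMF S) : Measure (ℕ → S × A) :=
  Kernel.trajMeasure (X := fun _ => S × A) (withAction π ν).toMeasure fun k =>
    (M.stepKernel π).comap (fun h : (i : Finset.Iic k) → S × A => h ⟨k, by simp⟩) (by fun_prop)

/-- `V_π(s) = 𝔼_π[∑ₖ γᵏ R(S_k, A_k) | S_0 = s]`, as a vector of Euclidean space. -/
def valueFunction [Countable S] [MeasurableSpace S] [DiscreteMeasurableSpace S]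
    [Countable A] [MeasurableSpace A] [DiscreteMeasurableSpace A]
    (M : MDP S A) (π : S → PMF A) : EuclideanSpace ℝ S :=
  WithLp.toLp 2 fun s =>
    ∫ ω, ∑' k : ℕ, M.γ ^ k * M.R (ω k).1 (ω k).2 ∂(M.pathMeasure π (PMF.pure s))

/-- The `n`-step temporal difference at time `k` along the trajectory `ω`. -/
def tdError (M : MDP S A) (n : ℕ) (V : S → ℝ) (ω : ℕ → S × A) (k : ℕ) : ℝ :=
  ∑ i ∈ Finset.range n, M.γ ^ i * M.R (ω (k + i)).1 (ω (k + i)).2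
    + M.γ ^ n * V (ω (k + n)).1 - V (ω k).1

/-- The `n`-step TD iterate `V_k` with stepsizes `α` and initial vector `V₀`, run along the
trajectory `ω`: at time `k` only the entry of the current state `S_k` is updated. -/
def nStepTD [DecidableEq S] (M : MDP S A) (n : ℕ) (α : ℕ → ℝ) (V₀ : EuclideanSpace ℝ S)
    (ω : ℕ → S × A) : ℕ → EuclideanSpace ℝ S
  | 0 => V₀
  | k + 1 => nStepTD M n α V₀ ω k +
      EuclideanSpace.single (ω k).1 (α k * M.tdError n (nStepTD M n α V₀ ω k) ω k)

end MDP

/-- A finite chain with transition matrix `P` is aperiodic: for every state, the possible return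
times have greatest common divisor `1`. -/
def IsAperiodicChain {S : Type*} [Fintype S] [DecidableEq S] (P : Matrix S S ℝ) : Prop :=
  ∀ s : S, ∀ d : ℕ, (∀ k : ℕ, 1 ≤ k → 0 < (P ^ k) s s → d ∣ k) → d = 1

/-- `κ` is a stationary distribution of `P`. -/
def IsStationaryDist {S : Type*} [Fintype S] (P : Matrix S S ℝ) (κ : S → ℝ) : Prop :=
  (∀ s, 0 ≤ κ s) ∧ ∑ s, κ s = 1 ∧ ∀ s', ∑ s, κ s * P s s' = κ s'

/-- Total variation distance of two probability vectors. -/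
def tvDist {S : Type*} [Fintype S] (p q : S → ℝ) : ℝ :=
  (1 / 2) * ∑ s, |p s - q s|

/-- The chain mixes to `κ` with constant `L`: for every precision `δ ∈ (0,1)` the mixing time
`t_δ = min {k | ∀ s, ‖P^k(s, ·) - κ‖_TV ≤ δ}` exists and is at most `L (log (1/δ) + 1)`. -/
def MixesWithConstant {S : Type*} [Fintype S] [DecidableEq S] (P : Matrix S S ℝ) (κ : S → ℝ)
    (L : ℝ) : Prop :=
  ∀ δ : ℝ, 0 < δ → δ < 1 → ∃ k : ℕ, (k : ℝ) ≤ L * (Real.log (1 / δ) + 1) ∧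
    ∀ s, tvDist ((P ^ k) s) κ ≤ δ

/-- `x · (1 + log x)ᵖ`, for quantities `x ≥ 1`: a bound `Õ(x)` is a bound by a constant times
`softO p x` for some exponent `p`. -/
def softO (p : ℕ) (x : ℝ) : ℝ := x * (1 + Real.log x) ^ p

end

/-! Write `z_k = V_k - V_π`, `b = 1/(1-γ)` and `μ = (1-γⁿ) K_min`. An update touches one coordinate,
so `‖z_k‖²` changes by `2α z_k(S_k)` times the temporal difference, plus `α²` times its square. If
`z` were independent of the current state and that state had law `κ`, the Bellman equation would
turn the mean temporal difference into `γⁿ Pⁿ z - z`, and Jensen's inequality with `κ P = κ` would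
give a drift of at most `-μ ‖z‖²` (`IsStationaryDist.drift_le`).

The iterate and the state are correlated, so the drift is evaluated at the iterate `z_j` frozen `τ =
n + t` steps earlier: `n` because `z_j` already uses the states before time `j + n`, and `t` to mix
to total variation `μ/8`, which costs only half of the drift (`integral_mul_tdError_le`). Within the
window the iterate moves by `O(ατ)(‖z_j‖ + b)`, so freezing costs `O(α²τ)(‖z_j‖² + b²)`
(`norm_sq_tdDeviation_succ_le`). When `400ατ ≤ μ` this yields the recursion `E‖z_{k+1}‖² ≤ (1 -
αμ/8) E‖z_k‖² + 201 α²τb²` for `k ≥ τ`.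

Iterating leaves an exponentially decaying bias and a noise floor of order `ατb²/μ`. The stepsize
`ε²μ/(4000τb²)` puts the floor below `ε²/2`, and the bias follows after about `τb²/(ε²μ²)` steps, up
to logarithms. The mixing precision depends on `μ` and not on `ε`, so `τ` carries no `log(1/ε)`.
Geometric mixing itself is Doeblin's argument for a primitive matrix. -/

/-! ### Finite stochastic matrices: mixing and the stationary drift. -/

section Stochastic

open Matrix

variable {S : Type*} [Fintype S] {P : Matrix S S ℝ} {κ : S → ℝ}

theorem mul_apply_le_mul_apply {A B : Matrix S S ℝ} (hA : ∀ i j, 0 ≤ A i j) (hB : ∀ i j, 0 ≤ B i j)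
    (i k j : S) : A i k * B k j ≤ (A * B) i j := by
  rw [Matrix.mul_apply]
  exact Finset.single_le_sum (f := fun k => A i k * B k j)
    (fun k _ => mul_nonneg (hA i k) (hB k j)) (Finset.mem_univ k)

theorem IsStationaryDist.vecMul_eq (hκ : IsStationaryDist P κ) : κ ᵥ* P = κ := by
  ext s
  simpa [vecMul, dotProduct] using hκ.2.2 s

theorem IsStationaryDist.nonempty (hκ : IsStationaryDist P κ) : Nonempty S := by
  by_contra h
  rw [not_nonempty_iff] at h
  have := hκ.2.1
  simp at this

theorem IsStationaryDist.le_one (hκ : IsStationaryDist P κ) (s : S) : κ s ≤ 1 := by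
  rw [← hκ.2.1]
  exact Finset.single_le_sum (fun s _ => hκ.1 s) (Finset.mem_univ s)

variable [DecidableEq S]

theorem IsStationaryDist.vecMul_pow_eq (hκ : IsStationaryDist P κ) (k : ℕ) :
    κ ᵥ* (P ^ k) = κ := by
  induction k with
  | zero => simp
  | succ k ih => rw [pow_succ, ← vecMul_vecMul, ih, hκ.vecMul_eq]

theorem IsStationaryDist.pos (hP : P ∈ rowStochastic ℝ S) (hirr : P.IsIrreducible)
    (hκ : IsStationaryDist P κ) (s : S) : 0 < κ s := by
  obtain ⟨s₀, h₀⟩ : ∃ s₀, 0 < κ s₀ := by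
    by_contra! h
    have := Finset.sum_nonpos fun s (_ : s ∈ Finset.univ) => h s
    rw [hκ.2.1] at this
    linarith
  obtain ⟨k, -, hk⟩ := (isIrreducible_iff_exists_pow_pos hirr.nonneg).1 hirr s₀ s
  rw [← hκ.vecMul_pow_eq k]
  exact (mul_pos h₀ hk).trans_le (Finset.single_le_sum (f := fun i => κ i * (P ^ k) i s)
    (fun i _ => mul_nonneg (hκ.1 i) (nonneg_of_mem_rowStochastic (pow_mem hP k)))
    (Finset.mem_univ s₀))

/-- An irreducible aperiodic stochastic matrix is primitive. -/
theorem exists_pow_pos_of_aperiodic (hP : P ∈ rowStochastic ℝ S) (hirr : P.IsIrreducible)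
    (hap : IsAperiodicChain P) : ∃ m : ℕ, 0 < m ∧ ∀ i j, 0 < (P ^ m) i j := by
  have hnn : ∀ k i j, 0 ≤ (P ^ k) i j := fun k i j =>
    nonneg_of_mem_rowStochastic (pow_mem hP k)
  have hret : ∀ s, ∃ N : ℕ, ∀ m ≥ N, 0 < (P ^ m) s s := by
    intro s
    set T : Set ℕ := {k | 1 ≤ k ∧ 0 < (P ^ k) s s}
    obtain ⟨N, hN⟩ := Nat.exists_mem_closure_of_ge T
    -- The return times form an additive semigroup; with gcd `1` it contains all large integers.
    have hg : Nat.setGcd T = 1 := hap s _ fun k hk hpos => Nat.setGcd_dvd_of_mem ⟨hk, hpos⟩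
    refine ⟨N, fun m hm => ?_⟩
    have hmem := hN m hm (by simp [hg])
    clear hm
    induction hmem using AddSubmonoid.closure_induction with
    | mem x hx => exact hx.2
    | zero => simp
    | add x y _ _ hx hy =>
      rw [pow_add]
      exact (mul_pos hx hy).trans_le (mul_apply_le_mul_apply (hnn x) (hnn y) s s s)
  choose N hN using hret
  choose K hK using (isIrreducible_iff_exists_pow_pos hirr.nonneg).1 hirr
  refine ⟨(∑ i, N i) + (∑ i, ∑ j, K i j) + 1, by omega, fun i j => ?_⟩
  have h1 : N i ≤ ∑ i, N i := Finset.single_le_sum (by simp) (Finset.mem_univ i)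
  have h2 : K i j ≤ ∑ i, ∑ j, K i j :=
    (Finset.single_le_sum (f := fun j => K i j) (by simp) (Finset.mem_univ j)).trans
      (Finset.single_le_sum (f := fun i => ∑ j, K i j) (by simp) (Finset.mem_univ i))
  -- Return to `i` in `r ≥ N i` steps, then reach `j` in `K i j` steps; summing over all states
  -- makes the total length the same for every pair.
  obtain ⟨r, hr⟩ : ∃ r, (∑ i, N i) + (∑ i, ∑ j, K i j) + 1 = r + K i j :=
    ⟨(∑ i, N i) + (∑ i, ∑ j, K i j) + 1 - K i j, by omega⟩
  rw [hr, pow_add]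
  exact (mul_pos (hN i r (by omega)) (hK i j).2).trans_le
    (mul_apply_le_mul_apply (hnn _) (hnn _) i i j)

/-- Doeblin's contraction: a stochastic matrix whose entries are at least `η` shrinks the `ℓ¹` norm
of vectors of total mass zero by the factor `1 - |S| η`. -/
theorem sum_abs_vecMul_le {Q : Matrix S S ℝ} (hQ : Q ∈ rowStochastic ℝ S) {η : ℝ}
    (hη : ∀ i j, η ≤ Q i j) {v : S → ℝ} (hv : ∑ s, v s = 0) :
    ∑ s, |(v ᵥ* Q) s| ≤ (1 - Fintype.card S * η) * ∑ s, |v s| := by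
  have h1 : ∀ s, |(v ᵥ* Q) s| ≤ ∑ i, |v i| * (Q i s - η) := by
    intro s
    -- As `v` has mass zero, lowering every entry by `η` changes nothing; the lowered rows are
    -- nonnegative with mass `1 - |S| η`.
    have : (v ᵥ* Q) s = ∑ i, v i * (Q i s - η) := by
      simp [vecMul, dotProduct, mul_sub, Finset.sum_sub_distrib, ← Finset.sum_mul, hv]
    rw [this]
    refine (Finset.abs_sum_le_sum_abs _ _).trans (Finset.sum_le_sum fun i _ => ?_)
    rw [abs_mul, abs_of_nonneg (sub_nonneg.2 (hη i s))]
  refine (Finset.sum_le_sum fun s _ => h1 s).trans (le_of_eq ?_)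
  rw [Finset.sum_comm, Finset.mul_sum]
  refine Finset.sum_congr rfl fun i _ => ?_
  rw [← Finset.mul_sum, Finset.sum_sub_distrib, sum_row_of_mem_rowStochastic hQ]
  simp [mul_comm]

theorem tvDist_pow_mul_le (hP : P ∈ rowStochastic ℝ S) (hκ : IsStationaryDist P κ) {m : ℕ} {θ : ℝ}
    (hθ0 : 0 ≤ θ) (hθ : ∀ v : S → ℝ, ∑ s, v s = 0 →
      ∑ s, |(v ᵥ* (P ^ m)) s| ≤ θ * ∑ s, |v s|) (j : ℕ) (s : S) :
    tvDist ((P ^ (m * j)) s) κ ≤ θ ^ j := by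
  have hmass : ∀ k, ∑ i, ((P ^ k) s i - κ i) = 0 := fun k => by
    rw [Finset.sum_sub_distrib, sum_row_of_mem_rowStochastic (pow_mem hP k), hκ.2.1, sub_self]
  have key : ∑ i, |(P ^ (m * j)) s i - κ i| ≤ 2 * θ ^ j := by
    induction j with
    | zero =>
      calc ∑ i, |(P ^ (m * 0)) s i - κ i| ≤ ∑ i, (|(P ^ (m * 0)) s i| + |κ i|) :=
            Finset.sum_le_sum fun i _ => abs_sub _ _
        _ = 2 := by
          have h0 := sum_row_of_mem_rowStochastic (pow_mem hP (m * 0)) s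
          rw [Finset.sum_add_distrib,
            Finset.sum_congr rfl fun i _ => abs_of_nonneg (hκ.1 i), hκ.2.1,
            Finset.sum_congr rfl fun i _ => abs_of_nonneg
              (nonneg_of_mem_rowStochastic (pow_mem hP (m * 0)) (i := s) (j := i)), h0]
          norm_num
        _ = _ := by simp
    | succ j ih =>
      have h1 := hθ (fun i => (P ^ (m * j)) s i - κ i) (hmass _)
      have h2 : ((fun i => (P ^ (m * j)) s i - κ i) ᵥ* (P ^ m)) =
          fun i => (P ^ (m * (j + 1))) s i - κ i := by
        change ((P ^ (m * j)) s - κ) ᵥ* (P ^ m) = _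
        rw [sub_vecMul, hκ.vecMul_pow_eq, mul_add, mul_one, pow_add]
        ext i
        simp [vecMul, dotProduct, Matrix.mul_apply]
      rw [h2] at h1
      calc _ ≤ _ := h1
        _ ≤ θ * (2 * θ ^ j) := by gcongr
        _ = _ := by ring
  unfold tvDist
  linarith

/-- An irreducible aperiodic finite chain mixes geometrically. -/
theorem exists_mixesWithConstant (hP : P ∈ rowStochastic ℝ S) (hirr : P.IsIrreducible)
    (hap : IsAperiodicChain P) (hκ : IsStationaryDist P κ) :
    ∃ L : ℝ, MixesWithConstant P κ L := by
  have := hκ.nonempty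
  obtain ⟨m, -, hm⟩ := exists_pow_pos_of_aperiodic hP hirr hap
  obtain ⟨⟨i₀, j₀⟩, h₀⟩ := Finite.exists_min fun x : S × S => (P ^ m) x.1 x.2
  -- The floor `1 / 2` keeps `θ` positive even when the Doeblin factor vanishes, so that `log (1 /
  -- θ)` can be divided by.
  set θ : ℝ := max (1 - Fintype.card S * (P ^ m) i₀ j₀) (1 / 2)
  have hθ1 : θ < 1 := by
    refine max_lt ?_ (by norm_num)
    have : 0 < (Fintype.card S : ℝ) * (P ^ m) i₀ j₀ := mul_pos (by positivity) (hm _ _)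
    linarith
  have hθ0 : 0 < θ := lt_of_lt_of_le (by norm_num) (le_max_right _ _)
  have hlog : 0 < Real.log (1 / θ) := Real.log_pos (by rw [lt_div_iff₀ hθ0]; linarith)
  have hcontr : ∀ v : S → ℝ, ∑ s, v s = 0 →
      ∑ s, |(v ᵥ* (P ^ m)) s| ≤ θ * ∑ s, |v s| := fun v hv =>
    (sum_abs_vecMul_le (pow_mem hP m) (fun i j => h₀ (i, j)) hv).trans
      (mul_le_mul_of_nonneg_right (le_max_left _ _) (by positivity))
  refine ⟨m * (1 + 1 / Real.log (1 / θ)), fun δ hδ hδ1 => ?_⟩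
  have hlδ : 0 < Real.log (1 / δ) := Real.log_pos (by rw [lt_div_iff₀ hδ]; linarith)
  set j := ⌈Real.log (1 / δ) / Real.log (1 / θ)⌉₊
  refine ⟨m * j, ?_, fun s => (tvDist_pow_mul_le hP hκ hθ0.le hcontr j s).trans ?_⟩
  · push_cast
    rw [mul_assoc]
    refine mul_le_mul_of_nonneg_left ?_ (Nat.cast_nonneg m)
    have h1 : (j : ℝ) < Real.log (1 / δ) / Real.log (1 / θ) + 1 := Nat.ceil_lt_add_one (by positivity)
    have h2 : 0 < 1 / Real.log (1 / θ) := by positivity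
    calc (j : ℝ) ≤ Real.log (1 / δ) / Real.log (1 / θ) + 1 := h1.le
      _ ≤ Real.log (1 / δ) / Real.log (1 / θ) + 1 + (Real.log (1 / δ) + 1 / Real.log (1 / θ)) := by
        linarith
      _ = _ := by ring
  · have h1 : Real.log (1 / δ) / Real.log (1 / θ) ≤ j := Nat.le_ceil _
    rw [div_le_iff₀ hlog] at h1
    rw [← Real.log_le_log_iff (by positivity) hδ, Real.log_pow]
    simp only [one_div, Real.log_inv] at h1
    linarith

theorem abs_mulVec_le {Q : Matrix S S ℝ} (hQ : Q ∈ rowStochastic ℝ S) {x : S → ℝ} {B : ℝ}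
    (hx : ∀ s, |x s| ≤ B) (s : S) : |(Q *ᵥ x) s| ≤ B := by
  calc |(Q *ᵥ x) s| ≤ ∑ i, |Q s i * x i| := Finset.abs_sum_le_sum_abs _ _
    _ ≤ ∑ i, Q s i * B := Finset.sum_le_sum fun i _ => by
        rw [abs_mul, abs_of_nonneg (nonneg_of_mem_rowStochastic hQ)]
        exact mul_le_mul_of_nonneg_left (hx i) (nonneg_of_mem_rowStochastic hQ)
    _ = B := by rw [← Finset.sum_mul, sum_row_of_mem_rowStochastic hQ, one_mul]

theorem sq_mulVec_le {Q : Matrix S S ℝ} (hQ : Q ∈ rowStochastic ℝ S) (x : S → ℝ) (s : S) :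
    (Q *ᵥ x) s ^ 2 ≤ (Q *ᵥ fun i => x i ^ 2) s := by
  exact Real.pow_arith_mean_le_arith_mean_pow_of_even _ (fun i => Q s i) x
    (fun i _ => nonneg_of_mem_rowStochastic hQ) (sum_row_of_mem_rowStochastic hQ s) even_two

/-- In the stationary regime the expected TD direction contracts the Euclidean norm. -/
theorem IsStationaryDist.drift_le (hP : P ∈ rowStochastic ℝ S) (hκ : IsStationaryDist P κ)
    {κ₀ g : ℝ} (hκ₀ : ∀ s, κ₀ ≤ κ s) (hg0 : 0 ≤ g) (hg1 : g ≤ 1) (n : ℕ) (x : S → ℝ) :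
    ∑ s, κ s * (x s * (g * ((P ^ n) *ᵥ x) s - x s)) ≤ -((1 - g) * κ₀) * ∑ s, x s ^ 2 := by
  have h1 : ∑ s, κ s * ((P ^ n) *ᵥ x) s ^ 2 ≤ ∑ s, κ s * x s ^ 2 := by
    calc ∑ s, κ s * ((P ^ n) *ᵥ x) s ^ 2 ≤ ∑ s, κ s * ((P ^ n) *ᵥ fun i => x i ^ 2) s :=
          Finset.sum_le_sum fun s _ => mul_le_mul_of_nonneg_left
            (sq_mulVec_le (pow_mem hP n) x s) (hκ.1 s)
      _ = κ ⬝ᵥ ((P ^ n) *ᵥ fun i => x i ^ 2) := rfl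
      _ = _ := by rw [dotProduct_mulVec, hκ.vecMul_pow_eq]; rfl
  -- Young's inequality `2xy ≤ x² + y²`; by `h1` the two halves of `g` then recombine to `(g - 1) ∑
  -- κ x²`.
  have h2 : ∑ s, κ s * (x s * (g * ((P ^ n) *ᵥ x) s - x s)) ≤
      ∑ s, (g / 2 * (κ s * ((P ^ n) *ᵥ x) s ^ 2) + (g / 2 - 1) * (κ s * x s ^ 2)) := by
    refine Finset.sum_le_sum fun s _ => ?_
    have := mul_nonneg (mul_nonneg hg0 (hκ.1 s)) (sq_nonneg (x s - ((P ^ n) *ᵥ x) s))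
    nlinarith
  have h3 : κ₀ * ∑ s, x s ^ 2 ≤ ∑ s, κ s * x s ^ 2 := by
    rw [Finset.mul_sum]
    exact Finset.sum_le_sum fun s _ => mul_le_mul_of_nonneg_right (hκ₀ s) (sq_nonneg _)
  rw [Finset.sum_add_distrib, ← Finset.mul_sum, ← Finset.mul_sum] at h2
  nlinarith [mul_le_mul_of_nonneg_left h1 hg0, mul_le_mul_of_nonneg_left h3 (sub_nonneg.2 hg1)]

/-- Close to stationarity the expected TD direction contracts the Euclidean norm. -/
theorem drift_le_of_tvDist_le (hP : P ∈ rowStochastic ℝ S) (hκ : IsStationaryDist P κ)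
    {κ₀ g δ : ℝ} (hκ₀ : ∀ s, κ₀ ≤ κ s) (hg0 : 0 ≤ g) (hg1 : g ≤ 1) (n : ℕ) (x : S → ℝ)
    {p : S → ℝ} (hp : tvDist p κ ≤ δ) :
    ∑ s, p s * (x s * (g * ((P ^ n) *ᵥ x) s - x s)) ≤
      -((1 - g) * κ₀ - 4 * δ) * ∑ s, x s ^ 2 := by
  set M := ∑ s, x s ^ 2
  have hx : ∀ s, |x s| ≤ √M := fun s => Real.abs_le_sqrt
    (Finset.single_le_sum (f := fun s => x s ^ 2) (fun s _ => sq_nonneg _) (Finset.mem_univ s))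
  have hM : 0 ≤ M := Finset.sum_nonneg fun s _ => sq_nonneg _
  have hy : ∀ s, |x s * (g * ((P ^ n) *ᵥ x) s - x s)| ≤ 2 * M := by
    intro s
    have h1 : |g * ((P ^ n) *ᵥ x) s - x s| ≤ 2 * √M := by
      have h2 := abs_mulVec_le (pow_mem hP n) hx s
      have h3 : |g * ((P ^ n) *ᵥ x) s| ≤ √M := by
        rw [abs_mul, abs_of_nonneg hg0]
        nlinarith [abs_nonneg (((P ^ n) *ᵥ x) s)]
      linarith [abs_sub (g * ((P ^ n) *ᵥ x) s) (x s), hx s]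
    rw [abs_mul]
    calc _ ≤ √M * (2 * √M) := mul_le_mul (hx s) h1 (abs_nonneg _) (Real.sqrt_nonneg _)
      _ = 2 * (√M * √M) := by ring
      _ = _ := by rw [Real.mul_self_sqrt hM]
  have h4 : ∑ s, p s * (x s * (g * ((P ^ n) *ᵥ x) s - x s)) ≤
      ∑ s, (κ s * (x s * (g * ((P ^ n) *ᵥ x) s - x s)) + |p s - κ s| * (2 * M)) := by
    refine Finset.sum_le_sum fun s _ => ?_
    have := (le_abs_self _).trans (abs_mul (p s - κ s)
      (x s * (g * ((P ^ n) *ᵥ x) s - x s))).le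
    have := mul_le_mul_of_nonneg_left (hy s) (abs_nonneg (p s - κ s))
    linarith
  rw [Finset.sum_add_distrib, ← Finset.sum_mul] at h4
  have h5 := hκ.drift_le hP hκ₀ hg0 hg1 n x
  unfold tvDist at hp
  -- `tvDist` is half the `ℓ¹` distance: `2δ` times the pointwise bound `2M` is the loss `4δ M`.
  have h6 : (∑ s, |p s - κ s|) * (2 * M) ≤ 2 * δ * (2 * M) :=
    mul_le_mul_of_nonneg_right (by linarith) (by positivity)
  change _ ≤ -((1 - g) * κ₀) * M at h5
  linarith

end Stochastic

/-! ### Initial marginal of a trajectory measure. -/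

namespace ProbabilityTheory.Kernel

theorem map_eval_zero_trajMeasure {X : ℕ → Type*} [∀ n, MeasurableSpace (X n)]
    (μ₀ : Measure (X 0)) (κ : (n : ℕ) → Kernel (Π i : Finset.Iic n, X i) (X (n + 1)))
    [∀ n, IsMarkovKernel (κ n)] :
    (trajMeasure μ₀ κ).map (fun ω => ω 0) = μ₀ := by
  let e : X 0 → (i : Finset.Iic 0) → X i :=
    (MeasurableEquiv.piUnique fun i : Finset.Iic 0 => X i).symm
  have he : Measurable e := (MeasurableEquiv.piUnique fun i : Finset.Iic 0 => X i).symm.measurable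
  have h1 : (trajMeasure μ₀ κ).map (Preorder.frestrictLe 0) = μ₀.map e := by
    rw [trajMeasure, Measure.map_comp _ _ (by fun_prop), traj_map_frestrictLe, partialTraj_self,
      Measure.id_comp]
    rfl
  have h2 : (trajMeasure μ₀ κ).map (fun ω => ω 0) =
      ((trajMeasure μ₀ κ).map (Preorder.frestrictLe 0)).map
        fun h : (i : Finset.Iic 0) → X i => h ⟨0, by simp⟩ := by
    rw [Measure.map_map (by fun_prop) (by fun_prop)]
    rfl
  rw [h2, h1, Measure.map_map (by fun_prop) he]
  exact Measure.map_id

end ProbabilityTheory.Kernel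

/-! ### Markov property along trajectories and the Bellman equation. -/

namespace MDP

section Trajectory

open Matrix

variable {S A : Type*}

theorem sum_toReal_eq_one {T : Type*} [Fintype T] (p : PMF T) : ∑ t, (p t).toReal = 1 := by
  rw [← ENNReal.toReal_sum fun t _ => p.apply_ne_top t, ← tsum_fintype (L := .unconditional T),
    p.tsum_coe, ENNReal.toReal_one]

theorem withAction_apply (π : S → PMF A) (ν : PMF S) (s : S) (a : A) :
    withAction π ν (s, a) = ν s * π s a := by
  classical
  rw [withAction, PMF.bind_apply, tsum_eq_single s]
  · rw [PMF.map_apply, tsum_eq_single a]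
    · simp
    · intro a' ha
      simp [ha.symm]
  · intro s' hs
    simp [PMF.map_apply, hs.symm]

/-- The mean of `g (s, a)` over the action `a ∼ π s`. -/
noncomputable def actionMean [Fintype A] (π : S → PMF A) (g : S × A → ℝ) (s : S) : ℝ :=
  ∑ a, (π s a).toReal * g (s, a)

section

variable [Fintype A]

theorem step_apply_toReal (M : MDP S A) (π : S → PMF A) (s s' : S) :
    (M.step π s s').toReal = ∑ a, (π s a).toReal * (M.P s a s').toReal := by
  rw [step, PMF.bind_apply, tsum_fintype, ENNReal.toReal_sum]
  · simp
  · exact fun a _ => ENNReal.mul_ne_top ((π s).apply_ne_top a) ((M.P s a).apply_ne_top s')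

/-- The mean reward in a state. -/
noncomputable def meanReward (M : MDP S A) (π : S → PMF A) : S → ℝ := actionMean π fun x => M.R x.1 x.2

theorem meanReward_mem (M : MDP S A) (π : S → PMF A) (s : S) : M.meanReward π s ∈ Set.Icc (0 : ℝ) 1 := by
  refine ⟨Finset.sum_nonneg fun a _ => mul_nonneg ENNReal.toReal_nonneg (M.R_mem s a).1, ?_⟩
  rw [← sum_toReal_eq_one (π s)]
  exact Finset.sum_le_sum fun a _ => mul_le_of_le_one_right ENNReal.toReal_nonneg (M.R_mem s a).2

theorem actionMean_state (π : S → PMF A) (φ : S → ℝ) :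
    actionMean π (fun x => φ x.1) = φ := by
  ext s
  simp [actionMean, ← Finset.sum_mul, sum_toReal_eq_one]

theorem actionMean_state_mul (π : S → PMF A) (φ : S → ℝ) (g : S × A → ℝ) :
    actionMean π (fun x => φ x.1 * g x) = fun s => φ s * actionMean π g s := by
  ext s
  simp only [actionMean, Finset.mul_sum]
  exact Finset.sum_congr rfl fun a _ => by ring

end

variable [Fintype S]

theorem transMatrix_mem_rowStochastic [DecidableEq S] (M : MDP S A) (π : S → PMF A) :
    M.transMatrix π ∈ rowStochastic ℝ S :=
  mem_rowStochastic_iff_sum.2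
    ⟨fun _ _ => ENNReal.toReal_nonneg, fun s => sum_toReal_eq_one (M.step π s)⟩

variable [Fintype A]

theorem actionMean_sum_P (M : MDP S A) (π : S → PMF A) (φ : S → ℝ) :
    actionMean π (fun x => ∑ s', (M.P x.1 x.2 s').toReal * φ s') = M.transMatrix π *ᵥ φ := by
  ext s
  simp only [actionMean, mulVec, dotProduct, transMatrix, of_apply, step_apply_toReal,
    Finset.sum_mul, Finset.mul_sum]
  rw [Finset.sum_comm]
  exact Finset.sum_congr rfl fun s' _ => Finset.sum_congr rfl fun a _ => by ring

theorem mulVec_actionMean (π : S → PMF A) (Q : Matrix S S ℝ) (g : S × A → ℝ) (s : S) :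
    (Q *ᵥ actionMean π g) s = ∑ y : S × A, g y * (Q s y.1 * (π y.1 y.2).toReal) := by
  rw [Fintype.sum_prod_type]
  simp only [mulVec, dotProduct, actionMean, Finset.mul_sum]
  exact Finset.sum_congr rfl fun s' _ => Finset.sum_congr rfl fun a _ => by ring

theorem pow_mulVec_meanReward_mem [DecidableEq S] (M : MDP S A) (π : S → PMF A) (k : ℕ) (s : S) :
    ((M.transMatrix π ^ k) *ᵥ M.meanReward π) s ∈ Set.Icc (0 : ℝ) 1 := by
  have hP := pow_mem (transMatrix_mem_rowStochastic M π) k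
  refine ⟨nonneg_mulVec_of_mem_rowStochastic hP (fun s => (M.meanReward_mem π s).1) s, ?_⟩
  refine (le_abs_self _).trans (abs_mulVec_le hP (fun i => ?_) s)
  rw [abs_of_nonneg (M.meanReward_mem π i).1]
  exact (M.meanReward_mem π i).2

/-- A function of finitely many coordinates of a trajectory factors through the initial segment. -/
theorem exists_eq_comp_frestrictLe {X E : Type*} [Nonempty E] {f : (ℕ → X) → E} {m : ℕ}
    (hf : DependsOn f (Set.Iic m)) :
    ∃ F : ((i : Finset.Iic m) → X) → E,
      ∀ ω, f ω = F (Preorder.frestrictLe (π := fun _ => X) m ω) := by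
  obtain ⟨F, hF⟩ := (dependsOn_iff_exists_comp (f := f)).1 hf
  refine ⟨fun h => F fun i => h ⟨i.1, Finset.mem_Iic.2 i.2⟩, fun ω => ?_⟩
  rw [hF]
  rfl

variable [MeasurableSpace S] [DiscreteMeasurableSpace S]
  [MeasurableSpace A] [DiscreteMeasurableSpace A]

theorem integral_withAction (π : S → PMF A) (ν : PMF S) (g : S × A → ℝ) :
    ∫ x, g x ∂(withAction π ν).toMeasure = ∑ s, (ν s).toReal * actionMean π g s := by
  rw [PMF.integral_eq_sum, Fintype.sum_prod_type]
  refine Finset.sum_congr rfl fun s _ => ?_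
  rw [actionMean, Finset.mul_sum]
  refine Finset.sum_congr rfl fun a _ => ?_
  rw [withAction_apply, ENNReal.toReal_mul, smul_eq_mul, mul_assoc]

variable (M : MDP S A) (π : S → PMF A) (ν : PMF S)

instance : IsProbabilityMeasure (M.pathMeasure π ν) := by
  unfold pathMeasure
  infer_instance

/-- The state-action space is finite, so such a function factors through a finite discrete space: it
is measurable and bounded. This settles integrability for all TD iterates. -/
theorem integrable_of_dependsOn {f : (ℕ → S × A) → ℝ} {m : ℕ}
    (hf : DependsOn f (Set.Iic m)) : Integrable f (M.pathMeasure π ν) := by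
  obtain ⟨F, hF⟩ := exists_eq_comp_frestrictLe hf
  obtain ⟨C, hC⟩ := (Set.finite_range F).isBounded.exists_norm_le
  have hmeas : Measurable f := by
    rw [show f = F ∘ Preorder.frestrictLe (π := fun _ => S × A) m from funext hF]
    exact (Measurable.of_discrete).comp (by fun_prop)
  refine Integrable.of_bound hmeas.aestronglyMeasurable C (ae_of_all _ fun ω => ?_)
  rw [hF]
  exact hC _ ⟨_, rfl⟩

theorem integral_eval_zero (g : S × A → ℝ) :
    ∫ ω, g (ω 0) ∂(M.pathMeasure π ν) = ∑ s, (ν s).toReal * actionMean π g s := by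
  rw [← integral_withAction]
  have h := Kernel.map_eval_zero_trajMeasure (X := fun _ => S × A) (withAction π ν).toMeasure
    fun k => (M.stepKernel π).comap (fun h : (i : Finset.Iic k) → S × A => h ⟨k, by simp⟩)
      (by fun_prop)
  conv_rhs => rw [← h]
  rw [integral_map (measurable_pi_apply 0).aemeasurable
    Measurable.of_discrete.aestronglyMeasurable]
  rfl

/-- The Markov property for one step of the state-action chain. -/
theorem integral_mul_eval_succ {f : (ℕ → S × A) → ℝ} {m : ℕ} (hf : DependsOn f (Set.Iic m))
    (g : S × A → ℝ) :
    ∫ ω, f ω * g (ω (m + 1)) ∂(M.pathMeasure π ν) =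
      ∫ ω, f ω * ∑ s, (M.P (ω m).1 (ω m).2 s).toReal * actionMean π g s
        ∂(M.pathMeasure π ν) := by
  obtain ⟨F, hF⟩ := exists_eq_comp_frestrictLe hf
  have key := Kernel.map_frestrictLe_trajMeasure_compProd_eq_map_trajMeasure
    (X := fun _ => S × A) (μ₀ := (withAction π ν).toMeasure) (κ := fun k =>
    (M.stepKernel π).comap (fun h : (i : Finset.Iic k) → S × A => h ⟨k, by simp⟩) (by fun_prop))
    (a := m)
  have h1 : ∫ ω, f ω * g (ω (m + 1)) ∂(M.pathMeasure π ν) =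
      ∫ x, F x.1 * g x.2 ∂((M.pathMeasure π ν).map
        fun ω => (Preorder.frestrictLe (π := fun _ => S × A) m ω, ω (m + 1))) := by
    rw [integral_map (by fun_prop) Measurable.of_discrete.aestronglyMeasurable]
    simp only [hF]
  rw [h1, pathMeasure, ← key, Measure.integral_compProd (Integrable.of_finite),
    integral_map (by fun_prop) Measurable.of_discrete.aestronglyMeasurable]
  refine integral_congr_ae (ae_of_all _ fun ω => ?_)
  simp only [hF, integral_const_mul]
  congr 1
  exact integral_withAction π _ g

/-- The action at time `m` is drawn from `π` given the past and the current state. -/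
theorem integral_mul_eval {f : (ℕ → S × A) → ℝ} {m : ℕ} (hf : DependsOn f (Set.Iio m))
    (g : S × A → ℝ) :
    ∫ ω, f ω * g (ω m) ∂(M.pathMeasure π ν) =
      ∫ ω, f ω * actionMean π g (ω m).1 ∂(M.pathMeasure π ν) := by
  cases m with
  | zero =>
    obtain ⟨c, hc⟩ : ∃ c, ∀ ω, f ω = c := by
      by_cases h : Nonempty (ℕ → S × A)
      · exact ⟨f h.some, fun ω => hf fun i hi => absurd hi (by simp)⟩
      · exact ⟨0, fun ω => absurd ⟨ω⟩ h⟩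
    simp only [hc, integral_const_mul]
    rw [integral_eval_zero, integral_eval_zero M π ν (fun x => actionMean π g x.1),
      actionMean_state]
  | succ m =>
    have hf' : DependsOn f (Set.Iic m) := hf.mono fun i hi => Nat.lt_succ_iff.1 hi
    rw [integral_mul_eval_succ M π ν hf',
      integral_mul_eval_succ M π ν hf' (fun x => actionMean π g x.1), actionMean_state]

variable [DecidableEq S]

/-- The factor `f` must not see the action at time `m`: only after averaging that action over `π` is
the next transition governed by `P_π`. In the induction `f ω * v (ω m).1` becomes the past of time
`m + 1`. -/
theorem integral_mul_state_mul_state (j : ℕ) {f : (ℕ → S × A) → ℝ} {m : ℕ}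
    (hf : DependsOn f (Set.Iio m)) (v φ : S → ℝ) :
    ∫ ω, f ω * (v (ω m).1 * φ (ω (m + j)).1) ∂(M.pathMeasure π ν) =
      ∫ ω, f ω * (v (ω m).1 * ((M.transMatrix π ^ j) *ᵥ φ) (ω m).1)
        ∂(M.pathMeasure π ν) := by
  induction j generalizing f m v φ with
  | zero => simp
  | succ j ih =>
    have hf' : DependsOn (fun ω : ℕ → S × A => f ω * v (ω m).1) (Set.Iio (m + 1)) := by
      intro ω ω' h
      simp only
      rw [hf fun i hi => h i (lt_trans hi (Nat.lt_succ_self m)), h m (Nat.lt_succ_self m)]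
    have h1 := ih hf' 1 φ
    simp only [Pi.one_apply, one_mul] at h1
    have h2 := integral_mul_eval_succ M π ν (f := fun ω : ℕ → S × A => f ω * v (ω m).1) (m := m)
      (hf'.mono fun i hi => Nat.le_of_lt_succ hi)
      (fun x => ((M.transMatrix π ^ j) *ᵥ φ) x.1)
    have h3 := integral_mul_eval M π ν hf fun x => v x.1 *
      ∑ s', (M.P x.1 x.2 s').toReal * ((M.transMatrix π ^ j) *ᵥ φ) s'
    rw [actionMean_state_mul, actionMean_sum_P, mulVec_mulVec, ← pow_succ'] at h3
    rw [actionMean_state] at h2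
    simp only [← mul_assoc] at h1 h2 h3 ⊢
    rw [← h3, ← h2, ← h1]
    simp only [add_assoc, add_comm 1 j]

theorem integral_mul_state_mul_eval (j : ℕ) {f : (ℕ → S × A) → ℝ} {m : ℕ}
    (hf : DependsOn f (Set.Iio m)) (v : S → ℝ) (g : S × A → ℝ) :
    ∫ ω, f ω * (v (ω m).1 * g (ω (m + j))) ∂(M.pathMeasure π ν) =
      ∫ ω, f ω * (v (ω m).1 * ((M.transMatrix π ^ j) *ᵥ actionMean π g) (ω m).1)
        ∂(M.pathMeasure π ν) := by
  rw [← integral_mul_state_mul_state M π ν j hf]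
  cases j with
  | zero =>
    simp only [add_zero]
    rw [integral_mul_eval M π ν hf fun x => v x.1 * g x, actionMean_state_mul]
  | succ j =>
    have hf' : DependsOn (fun ω : ℕ → S × A => f ω * v (ω m).1) (Set.Iio (m + (j + 1))) := by
      intro ω ω' h
      simp only
      rw [hf fun i hi => h i (Set.mem_Iio.2 (lt_of_lt_of_le hi (Nat.le_add_right _ _))),
        h m (show m < m + (j + 1) by omega)]
    have h := integral_mul_eval M π ν hf' g
    simpa only [mul_assoc] using h

/-- The Markov property with a frozen past: the part of the integrand determined before time `m`
may be treated as a constant. -/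
theorem integral_freeze (j : ℕ) {m : ℕ} (Φ : (ℕ → S × A) → S → S × A → ℝ)
    (hΦ : DependsOn Φ (Set.Iio m)) :
    ∫ ω, Φ ω (ω m).1 (ω (m + j)) ∂(M.pathMeasure π ν) =
      ∫ ω, ((M.transMatrix π ^ j) *ᵥ actionMean π (Φ ω (ω m).1)) (ω m).1
        ∂(M.pathMeasure π ν) := by
  classical
  have hdep : ∀ s y, DependsOn (fun ω => Φ ω s y) (Set.Iio m) := fun s y ω ω' h => by
    simp only
    rw [hΦ h]
  have hind : ∀ g : S × A → ℝ, ∀ s y, DependsOn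
      (fun ω => Φ ω s y * ((if (ω m).1 = s then 1 else 0) * g (ω (m + j)))) (Set.Iic (m + j)) := by
    intro g s y ω ω' h
    simp only
    rw [hΦ fun i hi => h i (Set.mem_Iic.2 (le_trans (Set.mem_Iio.1 hi).le (by omega))),
      h m (Set.mem_Iic.2 (by omega)), h (m + j) (Set.mem_Iic.2 le_rfl)]
  have hind' : ∀ φ : S → ℝ, ∀ s y, DependsOn
      (fun ω => Φ ω s y * ((if (ω m).1 = s then 1 else 0) * φ (ω m).1)) (Set.Iic m) := by
    intro g s y ω ω' h
    simp only
    rw [hΦ fun i hi => h i (Set.mem_Iic.2 (Set.mem_Iio.1 hi).le),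
      h m (Set.mem_Iic.2 le_rfl)]
  -- Expanding over the finitely many values of the state at `m` and the pair at `m + j` leaves
  -- coefficients that depend on the past alone, which reduces to the product form.
  have h1 : ∀ ω : ℕ → S × A, Φ ω (ω m).1 (ω (m + j)) =
      ∑ s, ∑ y, Φ ω s y * ((if (ω m).1 = s then 1 else 0) *
        (if ω (m + j) = y then (1 : ℝ) else 0)) := by
    intro ω
    simp
  have h2 : ∀ ω : ℕ → S × A, ((M.transMatrix π ^ j) *ᵥ actionMean π (Φ ω (ω m).1)) (ω m).1 =
      ∑ s, ∑ y, Φ ω s y * ((if (ω m).1 = s then 1 else 0) *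
        ((M.transMatrix π ^ j) *ᵥ actionMean π fun z => if z = y then 1 else 0) (ω m).1) := by
    intro ω
    simp [mulVec_actionMean]
  simp only [h1, h2]
  rw [integral_finsetSum _ fun s _ => integrable_finsetSum _ fun y _ =>
      integrable_of_dependsOn M π ν (hind (fun z => if z = y then 1 else 0) s y),
    integral_finsetSum _ fun s _ => integrable_finsetSum _ fun y _ =>
      integrable_of_dependsOn M π ν (hind' _ s y)]
  refine Finset.sum_congr rfl fun s _ => ?_
  rw [integral_finsetSum _ fun y _ =>
      integrable_of_dependsOn M π ν (hind (fun z => if z = y then 1 else 0) s y),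
    integral_finsetSum _ fun y _ => integrable_of_dependsOn M π ν (hind' _ s y)]
  exact Finset.sum_congr rfl fun y _ => integral_mul_state_mul_eval M π ν j (hdep s y)
    (fun z => if z = s then 1 else 0) (fun z => if z = y then 1 else 0)

theorem integral_reward_eq (k : ℕ) (s : S) :
    ∫ ω, M.R (ω k).1 (ω k).2 ∂(M.pathMeasure π (PMF.pure s)) =
      ((M.transMatrix π ^ k) *ᵥ M.meanReward π) s := by
  classical
  have h := integral_freeze M π (PMF.pure s) k (m := 0) (fun _ _ x => M.R x.1 x.2)
    fun _ _ _ => rfl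
  simp only [zero_add] at h
  change _ = ∫ ω : ℕ → S × A, ((M.transMatrix π ^ k) *ᵥ M.meanReward π) (ω 0).1 ∂_ at h
  rw [h, integral_eval_zero M π (PMF.pure s) fun x =>
    ((M.transMatrix π ^ k) *ᵥ M.meanReward π) x.1, actionMean_state, Finset.sum_eq_single s]
  · simp
  · intro s' _ hs
    simp [hs]
  · simp

/-- Rewards are nonnegative, so the integrals of the norms are the terms themselves, dominated by a
geometric series; sum and expectation may be exchanged. -/
theorem hasSum_valueFunction (s : S) :
    HasSum (fun k => M.γ ^ k * ((M.transMatrix π ^ k) *ᵥ M.meanReward π) s)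
      (M.valueFunction π s) := by
  have hgeo := summable_geometric_of_lt_one M.γ_pos.le M.γ_lt_one
  have hsum : Summable fun k => M.γ ^ k * ((M.transMatrix π ^ k) *ᵥ M.meanReward π) s :=
    Summable.of_nonneg_of_le
      (fun k => mul_nonneg (pow_nonneg M.γ_pos.le k) (M.pow_mulVec_meanReward_mem π k s).1)
      (fun k => mul_le_of_le_one_right (pow_nonneg M.γ_pos.le k)
        (M.pow_mulVec_meanReward_mem π k s).2) hgeo
  have hint : ∀ k, ∫ ω, M.γ ^ k * M.R (ω k).1 (ω k).2 ∂(M.pathMeasure π (PMF.pure s)) =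
      M.γ ^ k * ((M.transMatrix π ^ k) *ᵥ M.meanReward π) s := fun k => by
    rw [integral_const_mul, integral_reward_eq]
  have hI : ∀ k, Integrable (fun ω : ℕ → S × A => M.γ ^ k * M.R (ω k).1 (ω k).2)
      (M.pathMeasure π (PMF.pure s)) := fun k =>
    integrable_of_dependsOn M π _ (m := k) fun ω ω' h => by
      rw [h k (Set.mem_Iic.2 le_rfl)]
  have hnorm : ∀ k (ω : ℕ → S × A), ‖M.γ ^ k * M.R (ω k).1 (ω k).2‖ =
      M.γ ^ k * M.R (ω k).1 (ω k).2 := fun k ω =>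
    Real.norm_of_nonneg (mul_nonneg (pow_nonneg M.γ_pos.le k) (M.R_mem _ _).1)
  have h := hasSum_integral_of_summable_integral_norm hI (by simpa only [hnorm, hint] using hsum)
  simp only [hint] at h
  exact h

theorem valueFunction_mem (s : S) : M.valueFunction π s ∈ Set.Icc 0 (1 / (1 - M.γ)) := by
  refine ⟨(M.hasSum_valueFunction π s).nonneg fun k =>
    mul_nonneg (pow_nonneg M.γ_pos.le k) (M.pow_mulVec_meanReward_mem π k s).1, ?_⟩
  rw [one_div]
  exact hasSum_le (fun k => mul_le_of_le_one_right (pow_nonneg M.γ_pos.le k)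
    (M.pow_mulVec_meanReward_mem π k s).2) (M.hasSum_valueFunction π s)
    (hasSum_geometric_of_lt_one M.γ_pos.le M.γ_lt_one)

/-- The `n`-step Bellman equation. -/
theorem valueFunction_bellman (n : ℕ) (s : S) :
    M.valueFunction π s =
      ∑ i ∈ Finset.range n, M.γ ^ i * ((M.transMatrix π ^ i) *ᵥ M.meanReward π) s +
        M.γ ^ n * ((M.transMatrix π ^ n) *ᵥ M.valueFunction π) s := by
  have h1 := M.hasSum_valueFunction π s
  -- The tail of the value series from index `n` is `γⁿ Pⁿ` applied to the whole series.
  have h2 : HasSum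
      (fun k => M.γ ^ (k + n) * ((M.transMatrix π ^ (k + n)) *ᵥ M.meanReward π) s)
      (M.γ ^ n * ((M.transMatrix π ^ n) *ᵥ M.valueFunction π) s) := by
    have h3 := (hasSum_sum (s := Finset.univ) fun s' _ =>
      (M.hasSum_valueFunction π s').mul_left ((M.transMatrix π ^ n) s s')).mul_left (M.γ ^ n)
    refine h3.congr_fun ?_
    intro k
    rw [add_comm k n, pow_add (M.transMatrix π), ← mulVec_mulVec, pow_add, mul_assoc]
    congr 1
    simp only [mulVec, dotProduct, Finset.mul_sum]
    exact Finset.sum_congr rfl fun s' _ => Finset.sum_congr rfl fun a _ => by ring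
  rw [← h1.tsum_eq, ← h2.tsum_eq, h1.summable.sum_add_tsum_nat_add]

end Trajectory

end MDP

/-! ### Temporal differences: conditional drift and pathwise estimates. -/

namespace MDP

section TemporalDifference

open Matrix

variable {S A : Type*}

/-- The update producing `V_{k+1}` looks ahead to time `k + n`; this look-ahead is why the mixing
window later contains `n`. -/
theorem dependsOn_nStepTD [DecidableEq S] (M : MDP S A) (n : ℕ) (α : ℕ → ℝ) (V₀ : EuclideanSpace ℝ S) (k : ℕ) :
    DependsOn (fun ω => M.nStepTD n α V₀ ω k) (Set.Iio (k + n)) := by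
  induction k with
  | zero => exact fun _ _ _ => rfl
  | succ k ih =>
    intro ω ω' h
    have hω : ∀ i, i ≤ k + n → ω i = ω' i := fun i hi => h i (Set.mem_Iio.2 (by omega))
    have h1 : M.nStepTD n α V₀ ω k = M.nStepTD n α V₀ ω' k :=
      ih fun i hi => hω i (Set.mem_Iio.1 hi).le
    have h2 : ∀ V, M.tdError n V ω k = M.tdError n V ω' k := by
      intro V
      simp only [tdError]
      rw [hω k (by omega), hω (k + n) le_rfl]
      congr 2
      refine Finset.sum_congr rfl fun i hi => ?_
      rw [hω (k + i) (by have := Finset.mem_range.1 hi; omega)]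
    simp only [nStepTD, h1, h2]
    rw [hω k (by omega)]

theorem norm_sq_add_single [Fintype S] [DecidableEq S] (x : EuclideanSpace ℝ S) (s : S) (c : ℝ) :
    ‖x + EuclideanSpace.single s c‖ ^ 2 = ‖x‖ ^ 2 + 2 * (x s * c) + c ^ 2 := by
  rw [norm_add_sq_real, EuclideanSpace.inner_single_right, PiLp.norm_single,
    Real.norm_eq_abs, sq_abs]
  simp [mul_comm]

variable [Fintype S] [MeasurableSpace S] [DiscreteMeasurableSpace S]
  [Fintype A] [MeasurableSpace A] [DiscreteMeasurableSpace A]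
  (M : MDP S A) (π : S → PMF A)

/-- The temporal difference at the vector `V_π + z`. -/
noncomputable def shiftedTDError (n : ℕ) (z : EuclideanSpace ℝ S) (ω : ℕ → S × A) (k : ℕ) : ℝ :=
  M.tdError n (fun s => M.valueFunction π s + z s) ω k

theorem abs_shiftedTDError_sub_le (n : ℕ) (x z : EuclideanSpace ℝ S) (ω : ℕ → S × A) (k : ℕ) :
    |M.shiftedTDError π n x ω k - M.shiftedTDError π n z ω k| ≤ 2 * ‖x - z‖ := by
  have h1 : M.shiftedTDError π n x ω k - M.shiftedTDError π n z ω k =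
      M.γ ^ n * (x - z) (ω (k + n)).1 - (x - z) (ω k).1 := by
    simp only [shiftedTDError, tdError, PiLp.sub_apply]
    ring
  have h2 : ∀ s, |(x - z) s| ≤ ‖x - z‖ := fun s => PiLp.norm_apply_le (x - z) s
  have h3 : |M.γ ^ n * (x - z) (ω (k + n)).1| ≤ ‖x - z‖ := by
    rw [abs_mul, abs_of_nonneg (pow_nonneg M.γ_pos.le n)]
    exact (mul_le_of_le_one_left (abs_nonneg _)
      (pow_le_one₀ M.γ_pos.le M.γ_lt_one.le)).trans (h2 _)
  rw [h1]
  linarith [abs_sub (M.γ ^ n * (x - z) (ω (k + n)).1) ((x - z) (ω k).1), h2 (ω k).1]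

variable [DecidableEq S]

/-- The deviation of the `n`-step TD iterate with constant stepsize from the value function. -/
noncomputable def tdDeviation (n : ℕ) (α : ℝ) (V₀ : EuclideanSpace ℝ S) (ω : ℕ → S × A) (k : ℕ) :
    EuclideanSpace ℝ S :=
  M.nStepTD n (fun _ => α) V₀ ω k - M.valueFunction π

/-- At `V_π` itself, the bootstrapped return and the current value both lie in `[0, 1/(1-γ)]`, so
their difference does not exceed the length of that interval. -/
theorem abs_shiftedTDError_zero_le (n : ℕ) (ω : ℕ → S × A) (k : ℕ) :
    |M.shiftedTDError π n 0 ω k| ≤ 1 / (1 - M.γ) := by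
  have hγ : 0 < 1 - M.γ := by linarith [M.γ_lt_one]
  have h1 := M.valueFunction_mem π (ω k).1
  have h2 := M.valueFunction_mem π (ω (k + n)).1
  have hp := pow_nonneg M.γ_pos.le n
  have h3 : 0 ≤ ∑ i ∈ Finset.range n, M.γ ^ i * M.R (ω (k + i)).1 (ω (k + i)).2 :=
    Finset.sum_nonneg fun i _ => mul_nonneg (pow_nonneg M.γ_pos.le i) (M.R_mem _ _).1
  have h4 : ∑ i ∈ Finset.range n, M.γ ^ i * M.R (ω (k + i)).1 (ω (k + i)).2 ≤
      (1 - M.γ ^ n) * (1 / (1 - M.γ)) := by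
    calc _ ≤ ∑ i ∈ Finset.range n, M.γ ^ i := Finset.sum_le_sum fun i _ =>
          mul_le_of_le_one_right (pow_nonneg M.γ_pos.le i) (M.R_mem _ _).2
      _ = _ := by
        rw [geom_sum_eq M.γ_lt_one.ne, mul_one_div, ← neg_sub 1 M.γ, ← neg_sub 1 (M.γ ^ n),
          neg_div_neg_eq]
  have h5 := mul_le_mul_of_nonneg_left h2.2 hp
  have h6 := mul_nonneg hp h2.1
  simp only [shiftedTDError, tdError, PiLp.zero_apply, add_zero]
  rw [abs_le]
  constructor <;> linarith [h1.1, h1.2]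

theorem integral_state_mul_frozen (ν : PMF S) (j : ℕ) {k : ℕ} {z : (ℕ → S × A) → S → ℝ}
    {g : (ℕ → S × A) → S × A → ℝ}
    (hz : DependsOn z (Set.Iio k)) (hg : DependsOn g (Set.Iio k)) :
    ∫ ω, z ω (ω k).1 * g ω (ω (k + j)) ∂(M.pathMeasure π ν) =
      ∫ ω, z ω (ω k).1 * ((M.transMatrix π ^ j) *ᵥ actionMean π (g ω)) (ω k).1
        ∂(M.pathMeasure π ν) := by
  rw [integral_freeze M π ν j (fun ω s y => z ω s * g ω y)
    fun ω ω' h => by simp only [hz h, hg h]]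
  refine integral_congr_ae (ae_of_all _ fun ω => ?_)
  simp only [mulVec_actionMean, Finset.mul_sum]
  exact Finset.sum_congr rfl fun y _ => by ring

/-- Given the past, the expected temporal difference is `γⁿ Pⁿ z - z`, where `z` is the deviation of
the current vector from the value function. -/
theorem integral_mul_tdError (ν : PMF S) (n : ℕ) {k : ℕ} {z : (ℕ → S × A) → S → ℝ}
    (hz : DependsOn z (Set.Iio k)) :
    ∫ ω, z ω (ω k).1 * M.tdError n (fun s => M.valueFunction π s + z ω s) ω k
        ∂(M.pathMeasure π ν) =
      ∫ ω, z ω (ω k).1 * (M.γ ^ n * ((M.transMatrix π ^ n) *ᵥ z ω) (ω k).1 - z ω (ω k).1)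
        ∂(M.pathMeasure π ν) := by
  set P := M.transMatrix π
  set V := M.valueFunction π
  have hzi : ∀ {l : ℕ} {ω ω' : ℕ → S × A}, (∀ i ∈ Set.Iic (k + l), ω i = ω' i) → z ω = z ω' :=
    fun h => hz fun i hi => h i (Set.mem_Iic.2 ((Set.mem_Iio.1 hi).le.trans (Nat.le_add_right _ _)))
  have hR := fun i => integral_state_mul_frozen M π ν i hz (g := fun _ y => M.R y.1 y.2)
    fun _ _ _ => rfl
  have hV := integral_state_mul_frozen M π ν n hz (g := fun ω y => V y.1 + z ω y.1)
    fun ω ω' h => by simp only [hz h]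
  have hst : ∀ ω, actionMean π (fun y => V y.1 + z ω y.1) = fun s => V s + z ω s :=
    fun ω => actionMean_state π fun s => V s + z ω s
  simp only [hst] at hV
  have iR : ∀ i, Integrable (fun ω => M.γ ^ i *
      (z ω (ω k).1 * M.R (ω (k + i)).1 (ω (k + i)).2)) (M.pathMeasure π ν) := fun i =>
    integrable_of_dependsOn M π ν (m := k + i) fun ω ω' h => by
      rw [hzi h, h k (by simp), h (k + i) (by simp)]
  have iR' : ∀ i, Integrable (fun ω => M.γ ^ i *
      (z ω (ω k).1 * ((P ^ i) *ᵥ M.meanReward π) (ω k).1)) (M.pathMeasure π ν) := fun i =>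
    integrable_of_dependsOn M π ν (m := k + 0) fun ω ω' h => by
      rw [hzi h, h k (by simp)]
  have iV : Integrable (fun ω => M.γ ^ n *
      (z ω (ω k).1 * (V (ω (k + n)).1 + z ω (ω (k + n)).1))) (M.pathMeasure π ν) :=
    integrable_of_dependsOn M π ν (m := k + n) fun ω ω' h => by
      rw [hzi h, h k (by simp), h (k + n) (by simp)]
  have iV' : Integrable (fun ω => M.γ ^ n *
      (z ω (ω k).1 * ((P ^ n) *ᵥ fun s => V s + z ω s) (ω k).1)) (M.pathMeasure π ν) :=
    integrable_of_dependsOn M π ν (m := k + 0) fun ω ω' h => by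
      rw [hzi h, h k (by simp)]
  have i0 : Integrable (fun ω => z ω (ω k).1 * (V (ω k).1 + z ω (ω k).1))
      (M.pathMeasure π ν) :=
    integrable_of_dependsOn M π ν (m := k + 0) fun ω ω' h => by
      rw [hzi h, h k (by simp)]
  have e1 : ∀ ω : ℕ → S × A, z ω (ω k).1 * M.tdError n (fun s => V s + z ω s) ω k =
      ∑ i ∈ Finset.range n, M.γ ^ i * (z ω (ω k).1 * M.R (ω (k + i)).1 (ω (k + i)).2) +
        M.γ ^ n * (z ω (ω k).1 * (V (ω (k + n)).1 + z ω (ω (k + n)).1)) -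
        z ω (ω k).1 * (V (ω k).1 + z ω (ω k).1) := by
    intro ω
    simp only [tdError, mul_add, mul_sub, Finset.mul_sum, mul_left_comm (M.γ ^ _)]
  have e2 : ∀ ω : ℕ → S × A,
      z ω (ω k).1 * (M.γ ^ n * ((P ^ n) *ᵥ z ω) (ω k).1 - z ω (ω k).1) =
      ∑ i ∈ Finset.range n, M.γ ^ i * (z ω (ω k).1 * ((P ^ i) *ᵥ M.meanReward π) (ω k).1) +
        M.γ ^ n * (z ω (ω k).1 * ((P ^ n) *ᵥ fun s => V s + z ω s) (ω k).1) -
        z ω (ω k).1 * (V (ω k).1 + z ω (ω k).1) := by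
    intro ω
    -- The Bellman equation cancels the mean rewards and every `V_π` term, leaving only `z`.
    have hb := M.valueFunction_bellman π n (ω k).1
    have hadd : ((P ^ n) *ᵥ fun s => V s + z ω s) (ω k).1 =
        ((P ^ n) *ᵥ V) (ω k).1 + ((P ^ n) *ᵥ z ω) (ω k).1 :=
      congrFun (mulVec_add (P ^ n) V (z ω)) (ω k).1
    have hs : ∑ i ∈ Finset.range n, M.γ ^ i *
        (z ω (ω k).1 * ((P ^ i) *ᵥ M.meanReward π) (ω k).1) = z ω (ω k).1 *
        ∑ i ∈ Finset.range n, M.γ ^ i * ((P ^ i) *ᵥ M.meanReward π) (ω k).1 := by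
      rw [Finset.mul_sum]
      exact Finset.sum_congr rfl fun i _ => by ring
    rw [hs, hadd]
    change V (ω k).1 = ∑ i ∈ Finset.range n, M.γ ^ i * ((P ^ i) *ᵥ M.meanReward π) (ω k).1 +
      M.γ ^ n * ((P ^ n) *ᵥ V) (ω k).1 at hb
    linear_combination z ω (ω k).1 * hb
  simp only [e1, e2]
  have s1 := integrable_finsetSum (Finset.range n) fun i _ => iR i
  have s2 := integrable_finsetSum (Finset.range n) fun i _ => iR' i
  have s3 : Integrable (fun ω => ∑ i ∈ Finset.range n, M.γ ^ i *
      (z ω (ω k).1 * M.R (ω (k + i)).1 (ω (k + i)).2) +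
      M.γ ^ n * (z ω (ω k).1 * (V (ω (k + n)).1 + z ω (ω (k + n)).1)))
      (M.pathMeasure π ν) := s1.add iV
  have s4 : Integrable (fun ω => ∑ i ∈ Finset.range n, M.γ ^ i *
      (z ω (ω k).1 * ((P ^ i) *ᵥ M.meanReward π) (ω k).1) +
      M.γ ^ n * (z ω (ω k).1 * ((P ^ n) *ᵥ fun s => V s + z ω s) (ω k).1))
      (M.pathMeasure π ν) := s2.add iV'
  rw [integral_sub s3 i0, integral_sub s4 i0, integral_add s1 iV, integral_add s2 iV',
    integral_finsetSum _ fun i _ => iR i, integral_finsetSum _ fun i _ => iR' i]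
  simp only [integral_const_mul]
  rw [hV]
  congr 2
  exact Finset.sum_congr rfl fun i _ => congrArg _ (hR i)

/-- Once the chain has mixed, the expected temporal difference at a vector determined by the past
points towards the value function. -/
theorem integral_mul_tdError_le (ν : PMF S) {κ : S → ℝ}
    (hκ : IsStationaryDist (M.transMatrix π) κ) {κ₀ δ : ℝ} (hκ₀ : ∀ s, κ₀ ≤ κ s) {t : ℕ}
    (ht : ∀ s, tvDist ((M.transMatrix π ^ t) s) κ ≤ δ) (n : ℕ) {m : ℕ}
    {z : (ℕ → S × A) → S → ℝ} (hz : DependsOn z (Set.Iio m)) :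
    ∫ ω, z ω (ω (m + t)).1 * M.tdError n (fun s => M.valueFunction π s + z ω s) ω (m + t)
        ∂(M.pathMeasure π ν) ≤
      -((1 - M.γ ^ n) * κ₀ - 4 * δ) * ∫ ω, ∑ s, z ω s ^ 2 ∂(M.pathMeasure π ν) := by
  have hP := transMatrix_mem_rowStochastic M π
  -- Two conditionings: at time `m + t` to average the rewards and the next `n` transitions, then at
  -- time `m`, from which the `t`-step law is close to `κ`.
  rw [integral_mul_tdError M π ν n (hz.mono fun i hi => lt_of_lt_of_le hi (Nat.le_add_right _ _)),
    integral_freeze M π ν t (fun ω _ y => z ω y.1 *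
      (M.γ ^ n * ((M.transMatrix π ^ n) *ᵥ z ω) y.1 - z ω y.1))
      fun ω ω' h => by simp only [hz h], ← integral_const_mul]
  have hzi : ∀ {ω ω' : ℕ → S × A}, (∀ i ∈ Set.Iic m, ω i = ω' i) → z ω = z ω' :=
    fun h => hz fun i hi => h i (Set.mem_Iic.2 (Set.mem_Iio.1 hi).le)
  refine integral_mono
    (integrable_of_dependsOn M π ν (m := m) fun ω ω' h => by rw [hzi h, h m (by simp)])
    (integrable_of_dependsOn M π ν (m := m) fun ω ω' h => by rw [hzi h]) fun ω => ?_
  simp only [actionMean_state π fun s => z ω s *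
      (M.γ ^ n * ((M.transMatrix π ^ n) *ᵥ z ω) s - z ω s)]
  exact drift_le_of_tvDist_le hP hκ hκ₀ (pow_nonneg M.γ_pos.le n)
    (pow_le_one₀ M.γ_pos.le M.γ_lt_one.le) n (z ω) (ht _)

theorem tdDeviation_succ (n : ℕ) (α : ℝ) (V₀ : EuclideanSpace ℝ S) (ω : ℕ → S × A) (k : ℕ) :
    M.tdDeviation π n α V₀ ω (k + 1) = M.tdDeviation π n α V₀ ω k +
      EuclideanSpace.single (ω k).1
        (α * M.shiftedTDError π n (M.tdDeviation π n α V₀ ω k) ω k) := by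
  have h : (fun s => M.valueFunction π s + M.tdDeviation π n α V₀ ω k s) =
      M.nStepTD n (fun _ => α) V₀ ω k := by
    ext s
    simp [tdDeviation]
  rw [shiftedTDError, h, tdDeviation, tdDeviation, nStepTD]
  abel

theorem dependsOn_tdDeviation (n : ℕ) (α : ℝ) (V₀ : EuclideanSpace ℝ S) (k : ℕ) :
    DependsOn (fun ω => M.tdDeviation π n α V₀ ω k) (Set.Iio (k + n)) := fun ω ω' h => by
  simp only [tdDeviation]
  rw [show M.nStepTD n (fun _ => α) V₀ ω k = M.nStepTD n (fun _ => α) V₀ ω' k from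
    M.dependsOn_nStepTD n _ V₀ k h]

theorem abs_shiftedTDError_le (n : ℕ) (x : EuclideanSpace ℝ S) (ω : ℕ → S × A) (k : ℕ) :
    |M.shiftedTDError π n x ω k| ≤ 2 * (‖x‖ + 1 / (1 - M.γ)) := by
  have h1 := M.abs_shiftedTDError_sub_le π n x 0 ω k
  have h2 := M.abs_shiftedTDError_zero_le π n ω k
  rw [sub_zero] at h1
  have h3 := abs_sub_abs_le_abs_sub (M.shiftedTDError π n x ω k) (M.shiftedTDError π n 0 ω k)
  have h4 := abs_nonneg (M.shiftedTDError π n 0 ω k)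
  linarith

variable {n : ℕ} {α : ℝ} (V₀ : EuclideanSpace ℝ S) (ω : ℕ → S × A)

/-- Discrete Grönwall: one step moves the iterate by at most `2α (‖·‖ + b)` with `b = 1/(1-γ)`, so
`‖·‖ + b` grows at most by the factor `1 + 2α`. -/
theorem norm_tdDeviation_add_sub_le (hα : 0 ≤ α) (j i : ℕ) :
    ‖M.tdDeviation π n α V₀ ω (j + i) - M.tdDeviation π n α V₀ ω j‖ ≤
      ((1 + 2 * α) ^ i - 1) * (‖M.tdDeviation π n α V₀ ω j‖ + 1 / (1 - M.γ)) := by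
  induction i with
  | zero => simp
  | succ i ih =>
    set y := M.tdDeviation π n α V₀ ω (j + i)
    set z := M.tdDeviation π n α V₀ ω j
    have h1 : M.tdDeviation π n α V₀ ω (j + (i + 1)) - z = (y - z) +
        EuclideanSpace.single (ω (j + i)).1 (α * M.shiftedTDError π n y ω (j + i)) := by
      rw [← add_assoc, tdDeviation_succ]
      abel
    have h2 : ‖EuclideanSpace.single (ω (j + i)).1 (α * M.shiftedTDError π n y ω (j + i))‖ ≤
        α * (2 * (‖y‖ + 1 / (1 - M.γ))) := by
      rw [PiLp.norm_single, Real.norm_eq_abs, abs_mul, abs_of_nonneg hα]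
      exact mul_le_mul_of_nonneg_left (M.abs_shiftedTDError_le π n y ω (j + i)) hα
    have h3 : ‖y‖ ≤ ‖z‖ + ‖y - z‖ := norm_le_insert' y z
    rw [h1]
    refine (norm_add_le _ _).trans ?_
    rw [pow_succ]
    nlinarith

theorem norm_tdDeviation_add_sub_le_of_le (hα : 0 ≤ α) (j : ℕ) {τ : ℕ} (hτ : 2 * (α * τ) ≤ 1) :
    ‖M.tdDeviation π n α V₀ ω (j + τ) - M.tdDeviation π n α V₀ ω j‖ ≤
      4 * (α * τ) * (‖M.tdDeviation π n α V₀ ω j‖ + 1 / (1 - M.γ)) := by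
  have hγ : 0 < 1 - M.γ := by linarith [M.γ_lt_one]
  refine (M.norm_tdDeviation_add_sub_le π V₀ ω hα j τ).trans
    (mul_le_mul_of_nonneg_right ?_ (by positivity))
  have h1 : (1 + 2 * α) ^ τ ≤ Real.exp (2 * (α * τ)) := by
    calc (1 + 2 * α) ^ τ ≤ Real.exp (2 * α) ^ τ := by
          gcongr
          linarith [Real.add_one_le_exp (2 * α)]
      _ = _ := by
        rw [← Real.exp_nat_mul]
        ring_nf
  have h2 := Real.abs_exp_sub_one_le (x := 2 * (α * τ)) (by rwa [abs_of_nonneg (by positivity)])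
  rw [abs_of_nonneg (show 0 ≤ 2 * (α * τ) by positivity)] at h2
  linarith [le_abs_self (Real.exp (2 * (α * τ)) - 1)]

/-- One step of TD in terms of the temporal difference at the iterate `τ` steps earlier. -/
theorem norm_sq_tdDeviation_succ_le (hα : 0 ≤ α) (j : ℕ) {τ : ℕ} (hτ1 : 1 ≤ τ)
    (hτ : 2 * (α * τ) ≤ 1) :
    ‖M.tdDeviation π n α V₀ ω (j + τ + 1)‖ ^ 2 ≤ ‖M.tdDeviation π n α V₀ ω (j + τ)‖ ^ 2 +
      2 * α * (M.tdDeviation π n α V₀ ω j (ω (j + τ)).1 *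
        M.shiftedTDError π n (M.tdDeviation π n α V₀ ω j) ω (j + τ)) +
      200 * (α ^ 2 * τ) * (‖M.tdDeviation π n α V₀ ω j‖ ^ 2 + (1 / (1 - M.γ)) ^ 2) := by
  have hγ : 0 < 1 - M.γ := by linarith [M.γ_lt_one]
  rw [tdDeviation_succ, norm_sq_add_single]
  have hd := M.norm_tdDeviation_add_sub_le_of_le π (n := n) V₀ ω hα j hτ
  set x := M.tdDeviation π n α V₀ ω (j + τ)
  set z := M.tdDeviation π n α V₀ ω j
  set b := 1 / (1 - M.γ)
  set s := (ω (j + τ)).1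
  set Tx := M.shiftedTDError π n x ω (j + τ)
  set Tz := M.shiftedTDError π n z ω (j + τ)
  have hb : 0 < b := by positivity
  set y := ‖z‖ + b
  have hy : 0 < y := by positivity
  have hτ' : (1 : ℝ) ≤ τ := by exact_mod_cast hτ1
  have hx : ‖x‖ + b ≤ 3 * y := by
    have h1 : ‖x‖ ≤ ‖z‖ + ‖x - z‖ := norm_le_insert' x z
    have h2 : 4 * (α * τ) * y ≤ 2 * y := by nlinarith
    linarith [show y = ‖z‖ + b from rfl]
  have hTx : |Tx| ≤ 6 * y := (M.abs_shiftedTDError_le π n x ω (j + τ)).trans (by linarith)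
  have hTT : |Tx - Tz| ≤ 2 * ‖x - z‖ := M.abs_shiftedTDError_sub_le π n x z ω (j + τ)
  have hxs : |x s - z s| ≤ ‖x - z‖ := PiLp.norm_apply_le (x - z) s
  have hzs : |z s| ≤ y := (PiLp.norm_apply_le z s).trans (by linarith [show y = ‖z‖ + b from rfl])
  -- Split `xTx - zTz = (x - z)Tx + z(Tx - Tz)`, at most `8y ‖x - z‖`, and insert the drift bound
  -- `4ατ y`.
  have hmain : x s * Tx ≤ z s * Tz + 32 * (α * τ) * y ^ 2 := by
    have h1 : (x s - z s) * Tx ≤ ‖x - z‖ * (6 * y) :=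
      (le_abs_self _).trans (by
        rw [abs_mul]
        exact mul_le_mul hxs hTx (abs_nonneg _) (norm_nonneg _))
    have h2 : z s * (Tx - Tz) ≤ y * (2 * ‖x - z‖) :=
      (le_abs_self _).trans (by
        rw [abs_mul]
        exact mul_le_mul hzs hTT (abs_nonneg _) hy.le)
    have h3 : ‖x - z‖ * (8 * y) ≤ 4 * (α * τ) * y * (8 * y) :=
      mul_le_mul_of_nonneg_right hd (by positivity)
    nlinarith
  have hsq : Tx ^ 2 ≤ 36 * y ^ 2 := by
    rw [← sq_abs]
    calc |Tx| ^ 2 ≤ (6 * y) ^ 2 := by gcongr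
      _ = _ := by ring
  have hy2 : y ^ 2 ≤ 2 * (‖z‖ ^ 2 + b ^ 2) := by
    have : y = ‖z‖ + b := rfl
    nlinarith [sq_nonneg (‖z‖ - b)]
  have e1 : 2 * α * (x s * Tx) ≤ 2 * α * (z s * Tz + 32 * (α * τ) * y ^ 2) :=
    mul_le_mul_of_nonneg_left hmain (by positivity)
  have e2 : α ^ 2 * Tx ^ 2 ≤ α ^ 2 * τ * (36 * y ^ 2) := by
    calc α ^ 2 * Tx ^ 2 ≤ α ^ 2 * (36 * y ^ 2) := by gcongr
      _ ≤ α ^ 2 * τ * (36 * y ^ 2) := by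
        gcongr
        exact le_mul_of_one_le_right (by positivity) hτ'
  -- `100 = 2·32 + 36` collects the cross term and the squared step.
  have e3 : α ^ 2 * τ * (100 * y ^ 2) ≤ α ^ 2 * τ * (200 * (‖z‖ ^ 2 + b ^ 2)) :=
    mul_le_mul_of_nonneg_left (by linarith) (by positivity)
  nlinarith

/-- Used in reverse, to bound the frozen iterate from below by the current one, so that the
recursion has no delay. -/
theorem norm_sq_tdDeviation_add_le (hα : 0 ≤ α) (j : ℕ) {τ : ℕ} (hτ : 16 * (α * τ) ≤ 1) :
    ‖M.tdDeviation π n α V₀ ω (j + τ)‖ ^ 2 ≤ 4 * ‖M.tdDeviation π n α V₀ ω j‖ ^ 2 +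
      32 * (α * τ) ^ 2 * (1 / (1 - M.γ)) ^ 2 := by
  have hd := M.norm_tdDeviation_add_sub_le_of_le π (n := n) V₀ ω hα j (τ := τ) (by linarith [show 0 ≤ α * τ by positivity])
  set x := M.tdDeviation π n α V₀ ω (j + τ)
  set z := M.tdDeviation π n α V₀ ω j
  set b := 1 / (1 - M.γ)
  have h1 : ‖x‖ ≤ ‖z‖ + ‖x - z‖ := norm_le_insert' x z
  have h2 : ‖x‖ ≤ 5 / 4 * ‖z‖ + 4 * (α * τ) * b := by
    nlinarith [norm_nonneg z]
  calc ‖x‖ ^ 2 ≤ (5 / 4 * ‖z‖ + 4 * (α * τ) * b) ^ 2 := by gcongr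
    _ ≤ 2 * (5 / 4 * ‖z‖) ^ 2 + 2 * (4 * (α * τ) * b) ^ 2 := by
      nlinarith [sq_nonneg (5 / 4 * ‖z‖ - 4 * (α * τ) * b)]
    _ ≤ _ := by nlinarith [sq_nonneg ‖z‖]

end TemporalDifference

end MDP

/-! ### Mean-square recursion and its solution. -/

namespace MDP

section MeanSquare

open Matrix

variable {S A : Type*} [Fintype S] [DecidableEq S] [MeasurableSpace S] [DiscreteMeasurableSpace S]
  [Fintype A] [MeasurableSpace A] [DiscreteMeasurableSpace A]
  (M : MDP S A) (π : S → PMF A) (ν : PMF S) {n : ℕ} {α : ℝ} (V₀ : EuclideanSpace ℝ S)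

theorem integrable_comp_tdDeviation (n : ℕ) (α : ℝ) (k : ℕ) (F : EuclideanSpace ℝ S → ℝ) :
    Integrable (fun ω => F (M.tdDeviation π n α V₀ ω k)) (M.pathMeasure π ν) :=
  integrable_of_dependsOn M π ν (m := k + n) fun ω ω' h => by
    have := M.dependsOn_tdDeviation π n α V₀ k fun i hi => h i (Set.mem_Iic.2 (Set.mem_Iio.1 hi).le)
    exact congrArg F this

theorem integral_norm_sq_tdDeviation_succ_le {κ : S → ℝ}
    (hκ : IsStationaryDist (M.transMatrix π) κ) {κ₀ μ : ℝ} (hκ₀ : ∀ s, κ₀ ≤ κ s)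
    (hμ : μ = (1 - M.γ ^ n) * κ₀) (hμ0 : 0 ≤ μ) (hμ1 : μ ≤ 1) {t : ℕ}
    (ht : ∀ s, tvDist ((M.transMatrix π ^ t) s) κ ≤ μ / 8) (hn : 1 ≤ n) (hα : 0 ≤ α) {τ : ℕ}
    (hτ : τ = n + t) (hατ : 400 * (α * τ) ≤ μ) (j : ℕ) :
    ∫ ω, ‖M.tdDeviation π n α V₀ ω (j + τ + 1)‖ ^ 2 ∂(M.pathMeasure π ν) ≤
      (1 - α * μ / 8) * ∫ ω, ‖M.tdDeviation π n α V₀ ω (j + τ)‖ ^ 2 ∂(M.pathMeasure π ν) +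
        201 * (α ^ 2 * τ) * (1 / (1 - M.γ)) ^ 2 := by
  set b := 1 / (1 - M.γ)
  have hI := fun k => integrable_comp_tdDeviation M π ν V₀ n α k fun x => ‖x‖ ^ 2
  set a : ℕ → ℝ := fun k => ∫ ω, ‖M.tdDeviation π n α V₀ ω k‖ ^ 2 ∂(M.pathMeasure π ν)
  have hdrift := M.integral_mul_tdError_le π ν hκ hκ₀ ht n (m := j + n)
    (z := fun ω s => M.tdDeviation π n α V₀ ω j s)
    fun ω ω' h => funext fun s => congrArg (fun x : EuclideanSpace ℝ S => x s)
      (M.dependsOn_tdDeviation π n α V₀ j h)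
  have hcross : Integrable (fun ω => M.tdDeviation π n α V₀ ω j (ω (j + τ)).1 *
      M.shiftedTDError π n (M.tdDeviation π n α V₀ ω j) ω (j + τ)) (M.pathMeasure π ν) := by
    refine integrable_of_dependsOn M π ν (m := j + τ + n) fun ω ω' h => ?_
    have h1 : M.tdDeviation π n α V₀ ω j = M.tdDeviation π n α V₀ ω' j :=
      M.dependsOn_tdDeviation π n α V₀ j fun i hi => h i (by simp at hi ⊢; omega)
    have h2 : ∀ i, i ≤ n → ω (j + τ + i) = ω' (j + τ + i) := fun i hi => h _ (by simp; omega)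
    have h3 : ω (j + τ) = ω' (j + τ) := h2 0 (by omega)
    rw [h1, h3]
    congr 1
    simp only [shiftedTDError, tdError]
    rw [h2 n le_rfl, h3]
    congr 2
    exact Finset.sum_congr rfl fun i hi => by rw [h2 i (Finset.mem_range.1 hi).le]
  have hdrift' : ∫ ω, M.tdDeviation π n α V₀ ω j (ω (j + τ)).1 *
      M.shiftedTDError π n (M.tdDeviation π n α V₀ ω j) ω (j + τ) ∂(M.pathMeasure π ν) ≤
      -(μ / 2) * a j := by
    -- The iterate at `j` is determined before time `j + n`; the remaining `t` steps are for mixing.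
    -- The drift `-(μ - 4·μ/8)` is `-μ/2`.
    have e : j + τ = j + n + t := by omega
    simp only [e, shiftedTDError]
    refine hdrift.trans (le_of_eq ?_)
    simp only [a, EuclideanSpace.real_norm_sq_eq]
    rw [← hμ]
    ring
  have hu : 0 ≤ α * τ := by positivity
  have h1 : a (j + τ + 1) ≤ a (j + τ) + 2 * α * (-(μ / 2) * a j) +
      200 * (α ^ 2 * τ) * (a j + b ^ 2) := by
    have i1 := (hI (j + τ)).add (hcross.const_mul (2 * α))
    have i2 := ((hI j).add (integrable_const (b ^ 2))).const_mul (200 * (α ^ 2 * τ))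
    have hmono := integral_mono (hI (j + τ + 1)) (i1.add i2) fun ω =>
      M.norm_sq_tdDeviation_succ_le π V₀ ω hα j (τ := τ) (by omega) (by linarith)
    rw [integral_add' i1 i2, integral_add' (hI (j + τ)) (hcross.const_mul (2 * α)),
      integral_const_mul, integral_const_mul, integral_add' (hI j) (integrable_const (b ^ 2)),
      integral_const] at hmono
    simp only [probReal_univ, one_smul] at hmono
    exact hmono.trans (by gcongr)
  have h2 : a (j + τ) ≤ 4 * a j + 32 * (α * τ) ^ 2 * b ^ 2 := by
    have i1 := (hI j).const_mul 4
    have hmono := integral_mono (hI (j + τ)) (i1.add (integrable_const (32 * (α * τ) ^ 2 * b ^ 2)))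
      fun ω => M.norm_sq_tdDeviation_add_le π V₀ ω hα j (τ := τ) (by linarith)
    rw [integral_add' i1 (integrable_const _), integral_const_mul, integral_const] at hmono
    simpa only [probReal_univ, one_smul] using hmono
  have ha : 0 ≤ a j := integral_nonneg fun ω => sq_nonneg _
  change a (j + τ + 1) ≤ (1 - α * μ / 8) * a (j + τ) + _
  -- Freezing costs at most half of the drift `-αμ a j`; the other half dominates `αμ/8 · a (j + τ)`
  -- up to one more unit of noise, whence `201`.
  have e1 : α * (400 * (α * τ)) * a j ≤ α * μ * a j := by gcongr
  have e2 : α * μ / 8 * a (j + τ) ≤ α * μ / 8 * (4 * a j + 32 * (α * τ) ^ 2 * b ^ 2) := by gcongr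
  have e3 : α * (α * τ) * b ^ 2 * (4 * μ * (α * τ)) ≤ α * (α * τ) * b ^ 2 * 1 := by
    refine mul_le_mul_of_nonneg_left ?_ (by positivity)
    nlinarith
  nlinarith

theorem integral_norm_sq_tdDeviation_add_le {κ : S → ℝ}
    (hκ : IsStationaryDist (M.transMatrix π) κ) {κ₀ μ : ℝ} (hκ₀ : ∀ s, κ₀ ≤ κ s)
    (hμ : μ = (1 - M.γ ^ n) * κ₀) (hμ0 : 0 < μ) (hμ1 : μ ≤ 1) {t : ℕ}
    (ht : ∀ s, tvDist ((M.transMatrix π ^ t) s) κ ≤ μ / 8) (hn : 1 ≤ n) (hα : 0 < α)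
    (hα1 : α ≤ 1) {τ : ℕ}
    (hτ : τ = n + t) (hατ : 400 * (α * τ) ≤ μ) (i : ℕ) :
    ∫ ω, ‖M.tdDeviation π n α V₀ ω (τ + i)‖ ^ 2 ∂(M.pathMeasure π ν) ≤
      4 * Real.exp (-(α * μ / 8 * i)) * ‖V₀ - M.valueFunction π‖ ^ 2 +
        1609 * (α * τ) / μ * (1 / (1 - M.γ)) ^ 2 := by
  set b := 1 / (1 - M.γ)
  set a : ℕ → ℝ := fun k => ∫ ω, ‖M.tdDeviation π n α V₀ ω k‖ ^ 2 ∂(M.pathMeasure π ν)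
  set r := 1 - α * μ / 8 with hr
  set X := ‖V₀ - M.valueFunction π‖
  have hr0 : 0 ≤ r := by nlinarith
  have hr1 : r ≤ 1 := by nlinarith [mul_pos hα hμ0]
  have hu : 0 ≤ α * τ := by positivity
  have hstart : a τ ≤ 4 * X ^ 2 + 32 * (α * τ) ^ 2 * b ^ 2 := by
    have hmono := integral_mono (integrable_comp_tdDeviation M π ν V₀ n α τ fun x => ‖x‖ ^ 2)
      (integrable_const (4 * X ^ 2 + 32 * (α * τ) ^ 2 * b ^ 2)) fun ω => by
        have := M.norm_sq_tdDeviation_add_le π (n := n) V₀ ω hα.le 0 (τ := τ) (by linarith)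
        rw [zero_add] at this
        exact this
    rw [integral_const] at hmono
    simpa only [probReal_univ, one_smul] using hmono
  -- The floor `1608 ατ/μ · b²` is the fixed point of the recursion: `201 α²τb²` divided by `αμ/8`.
  have hrec : ∀ i, a (τ + i) ≤ r ^ i * a τ + 1608 * (α * τ) / μ * b ^ 2 := by
    intro i
    induction i with
    | zero =>
      simp only [add_zero, pow_zero, one_mul]
      exact le_add_of_nonneg_right (by positivity)
    | succ i ih =>
      have h := M.integral_norm_sq_tdDeviation_succ_le π ν V₀ hκ hκ₀ hμ hμ0.le hμ1 ht hn hα.le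
        hτ hατ i
      rw [add_comm i τ] at h
      calc a (τ + (i + 1)) ≤ r * a (τ + i) + 201 * (α ^ 2 * τ) * b ^ 2 := h
        _ ≤ r * (r ^ i * a τ + 1608 * (α * τ) / μ * b ^ 2) + 201 * (α ^ 2 * τ) * b ^ 2 := by
          gcongr
        _ = _ := by
          rw [hr]
          field_simp
          ring
  have hexp : r ^ i ≤ Real.exp (-(α * μ / 8 * i)) := by
    calc r ^ i ≤ Real.exp (-(α * μ / 8)) ^ i := by
          gcongr
          linarith [Real.add_one_le_exp (-(α * μ / 8))]
      _ = _ := by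
        rw [← Real.exp_nat_mul]
        ring_nf
  have hsmall : 32 * (α * τ) ^ 2 * b ^ 2 ≤ 1 * (α * τ) / μ * b ^ 2 := by
    have : 32 * (α * τ) ^ 2 ≤ 1 * (α * τ) / μ := by
      rw [le_div_iff₀ hμ0]
      nlinarith [mul_nonneg hu hu, mul_nonneg hu hμ0.le]
    gcongr
  calc a (τ + i) ≤ r ^ i * a τ + 1608 * (α * τ) / μ * b ^ 2 := hrec i
    _ ≤ r ^ i * (4 * X ^ 2 + 32 * (α * τ) ^ 2 * b ^ 2) + 1608 * (α * τ) / μ * b ^ 2 := by gcongr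
    _ ≤ Real.exp (-(α * μ / 8 * i)) * (4 * X ^ 2) + 1 * (32 * (α * τ) ^ 2 * b ^ 2) +
        1608 * (α * τ) / μ * b ^ 2 := by
      rw [mul_add]
      gcongr
      exact pow_le_one₀ hr0 hr1
    _ ≤ Real.exp (-(α * μ / 8 * i)) * (4 * X ^ 2) + 1 * (1 * (α * τ) / μ * b ^ 2) +
        1608 * (α * τ) / μ * b ^ 2 := by gcongr
    _ = _ := by ring

theorem norm_valueFunction_le :
    ‖M.valueFunction π‖ ≤ Real.sqrt (Fintype.card S) * (1 / (1 - M.γ)) := by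
  have hγ : 0 < 1 - M.γ := by linarith [M.γ_lt_one]
  rw [EuclideanSpace.norm_eq]
  refine Real.sqrt_le_iff.2 ⟨by positivity, ?_⟩
  rw [mul_pow, Real.sq_sqrt (Nat.cast_nonneg _), ← nsmul_eq_mul, ← Finset.card_univ,
    ← Finset.sum_const]
  refine Finset.sum_le_sum fun s _ => ?_
  have h := M.valueFunction_mem π s
  rw [Real.norm_of_nonneg h.1]
  exact pow_le_pow_left₀ h.1 h.2 2

theorem integral_le_of_integral_sq_le {Ω : Type*} [MeasurableSpace Ω] {P : Measure Ω}
    [IsProbabilityMeasure P] {f : Ω → ℝ} (hf : Integrable f P)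
    (hf2 : Integrable (fun ω => f ω ^ 2) P) {ε : ℝ} (hε : 0 < ε) (h : ∫ ω, f ω ^ 2 ∂P ≤ ε ^ 2) :
    ∫ ω, f ω ∂P ≤ ε := by
  have i1 := hf.const_mul (2 * ε)
  have i2 := hf2.add (integrable_const (ε ^ 2))
  have hmono := integral_mono i1 i2 fun ω => by
    have := sq_nonneg (f ω - ε)
    simp only [Pi.add_apply]
    linarith
  rw [integral_const_mul, integral_add' hf2 (integrable_const _), integral_const] at hmono
  simp only [probReal_univ, one_smul] at hmono
  nlinarith

end MeanSquare

end MDP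

/-! ### Stepsize choice and counting of samples. -/

section SampleCount

/-- `log (8/(gκ₀))` is a constant plus `-log g - log κ₀`, and both are absorbed by the logarithmic
factors of the final bound. -/
theorem mixing_window_le {g κ₀ L : ℝ} {n t : ℕ} (hn : 1 ≤ n) (hg : 0 < g)
    (hg1 : g ≤ 1) (hκ : 0 < κ₀) (hκ1 : κ₀ ≤ 1) (hL : 0 ≤ L)
    (ht : (t : ℝ) ≤ L * (Real.log (1 / (g * κ₀ / 8)) + 1)) :
    ((n + t : ℕ) : ℝ) ≤
      4 * n * (1 + L) * (1 + Real.log (n / g ^ 2)) * (1 + Real.log (1 / κ₀ ^ 2)) := by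
  have hn' : (1 : ℝ) ≤ n := by exact_mod_cast hn
  have hlog : Real.log (1 / (g * κ₀ / 8)) = 3 * Real.log 2 - Real.log g - Real.log κ₀ := by
    rw [one_div_div, Real.log_div (by norm_num) (by positivity), Real.log_mul hg.ne' hκ.ne',
      show (8 : ℝ) = 2 ^ 3 by norm_num, Real.log_pow]
    push_cast
    ring
  have hq : Real.log (n / g ^ 2) = Real.log n - 2 * Real.log g := by
    rw [Real.log_div (by positivity) (by positivity), Real.log_pow]
    push_cast
    ring
  have hK : Real.log (1 / κ₀ ^ 2) = - 2 * Real.log κ₀ := by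
    rw [one_div, Real.log_inv, Real.log_pow]
    push_cast
    ring
  have h2 := Real.log_two_lt_d9
  have hn0 := Real.log_nonneg hn'
  have hg0 := Real.log_nonpos hg.le hg1
  have hκ0 := Real.log_nonpos hκ.le hκ1
  rw [hlog] at ht
  rw [hq, hK]
  set u := -Real.log g
  set w := -Real.log κ₀
  have h3 : (t : ℝ) ≤ L * (4 + u + w) := ht.trans (mul_le_mul_of_nonneg_left (by linarith) hL)
  have h4 : 4 + u + w ≤ 4 * ((1 + (Real.log n - 2 * Real.log g)) * (1 + -2 * Real.log κ₀)) := by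
    have : 0 ≤ (Real.log n - 2 * Real.log g) * (-2 * Real.log κ₀) :=
      mul_nonneg (by linarith) (by linarith)
    linarith
  set Y := (1 + (Real.log n - 2 * Real.log g)) * (1 + -2 * Real.log κ₀)
  have hY : 1 ≤ 4 * Y := by linarith
  push_cast
  calc (n : ℝ) + t ≤ n * (4 * Y) + L * (4 * Y) := by
        gcongr
        · exact le_mul_of_one_le_right (by linarith) hY
        · exact h3.trans (by gcongr)
    _ ≤ n * (4 * Y) + n * L * (4 * Y) := by
        gcongr
        exact le_mul_of_one_le_left hL hn'
    _ = _ := by ring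

/-- Taking logarithms gives a sum; `ε ≤ 1/2` makes `2 log (1/ε) ≥ 1`, so the sum is bounded by a
product of factors `1 + log`. -/
theorem initial_error_le {γ ε v Z x : ℝ} (hγ0 : 0 ≤ γ) (hγ : γ < 1) (hε : 0 < ε) (hε2 : ε ≤ 1 / 2)
    (hv : 0 ≤ v) (hZ : 1 ≤ Z) (hx0 : 0 ≤ x) (hx : x ≤ v + Z * (1 / (1 - γ))) :
    8 * x ^ 2 / ε ^ 2 ≤ Real.exp (9 * Real.log (1 / ε) * (1 + Real.log (1 + v)) *
      (1 + Real.log Z) * (1 + Real.log (1 / (1 - γ) ^ 2))) := by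
  have hg : 0 < 1 - γ := by linarith
  have hb : 1 ≤ 1 / (1 - γ) := by rw [le_div_iff₀ hg]; linarith
  set b := 1 / (1 - γ)
  have hbg : 1 / (1 - γ) ^ 2 = b ^ 2 := by rw [one_div_pow]
  have hx' : x ≤ 2 * ((1 + v) * Z * b) := by
    have h1 : 1 ≤ Z * b := one_le_mul_of_one_le_of_one_le hZ hb
    nlinarith
  have hpos : 0 < 1 + v := by linarith
  calc 8 * x ^ 2 / ε ^ 2 ≤ 8 * (2 * ((1 + v) * Z * b)) ^ 2 / ε ^ 2 := by gcongr
    _ = Real.exp (Real.log (2 ^ 5 * (1 + v) ^ 2 * Z ^ 2 * b ^ 2 * (1 / ε) ^ 2)) := by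
      rw [Real.exp_log (by positivity)]
      field_simp
      ring
    _ ≤ _ := by
      rw [Real.exp_le_exp, Real.log_mul (by positivity) (by positivity),
        Real.log_mul (by positivity) (by positivity), Real.log_mul (by positivity) (by positivity),
        Real.log_mul (by positivity) (by positivity), Real.log_pow, Real.log_pow, Real.log_pow,
        Real.log_pow (n := 2) (x := 1 / ε), hbg]
      have h2 : Real.log 2 ≤ Real.log (1 / ε) :=
        Real.log_le_log (by norm_num) (by rw [le_div_iff₀ hε]; linarith)
      have h3 := Real.log_two_gt_d9
      have hv0 := Real.log_nonneg (show 1 ≤ 1 + v by linarith)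
      have hZ0 := Real.log_nonneg hZ
      have hb0 := Real.log_nonneg (one_le_pow₀ hb : 1 ≤ b ^ 2)
      set l := Real.log (1 / ε)
      set p := Real.log (1 + v)
      set q := Real.log Z
      set r := Real.log (b ^ 2)
      have hl : 1 ≤ 2 * l := by linarith
      have h4 : 1 + p + q + r ≤ (1 + p) * (1 + q) * (1 + r) := by
        have := mul_nonneg hv0 hZ0
        have := mul_nonneg hv0 hb0
        have := mul_nonneg hZ0 hb0
        have := mul_nonneg (mul_nonneg hv0 hZ0) hb0
        linarith
      have h5 := mul_le_mul_of_nonneg_left h4 (show 0 ≤ 9 * l by linarith)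
      have h6 := mul_nonneg (show 0 ≤ 2 * l - 1 by linarith) hv0
      have h7 := mul_nonneg (show 0 ≤ 2 * l - 1 by linarith) hZ0
      have h8 := mul_nonneg (show 0 ≤ 2 * l - 1 by linarith) hb0
      push_cast
      linarith [mul_nonneg (show 0 ≤ l by linarith) hv0, mul_nonneg (show 0 ≤ l by linarith) hZ0,
        mul_nonneg (show 0 ≤ l by linarith) hb0]

theorem sample_count_ge {γ g κ₀ L ε v Z N τ : ℝ} {n : ℕ} (hn : 1 ≤ n) (hγ0 : 0 ≤ γ) (hγ : γ < 1)
    (hg : 0 < g) (hg1 : g ≤ 1) (hκ : 0 < κ₀) (hκ1 : κ₀ ≤ 1) (hL : 0 ≤ L) (hε : 0 < ε)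
    (hε2 : ε ≤ 1 / 2) (hv : 0 ≤ v) (hZ : 1 ≤ Z)
    (hτ : τ ≤ 4 * n * (1 + L) * (1 + Real.log (n / g ^ 2)) * (1 + Real.log (1 / κ₀ ^ 2)))
    (hN : 2304144 * (Real.log (1 / ε) ^ 2 / ε ^ 2) * softO 1 (1 / (1 - γ) ^ 2) *
      softO 1 (n / g ^ 2) * softO 1 (1 / κ₀ ^ 2) * softO 1 Z * softO 1 (1 + L) *
      (1 + Real.log (1 + v)) ^ 1 ≤ N) :
    32002 * τ * (1 / (1 - γ)) ^ 2 / (ε ^ 2 * (g * κ₀) ^ 2) *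
      (9 * Real.log (1 / ε) * (1 + Real.log (1 + v)) *
      (1 + Real.log Z) * (1 + Real.log (1 / (1 - γ) ^ 2))) ≤ N := by
  have hγ' : 0 < 1 - γ := by linarith
  have hn' : (1 : ℝ) ≤ n := by exact_mod_cast hn
  have hl : 1 ≤ 2 * Real.log (1 / ε) := by
    have h2 : Real.log 2 ≤ Real.log (1 / ε) :=
      Real.log_le_log (by norm_num) (by rw [le_div_iff₀ hε]; linarith)
    linarith [Real.log_two_gt_d9]
  have hb0 := Real.log_nonneg (show 1 ≤ 1 / (1 - γ) ^ 2 by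
    rw [le_div_iff₀ (by positivity)]; nlinarith)
  have hq0 := Real.log_nonneg (show 1 ≤ n / g ^ 2 by
    rw [le_div_iff₀ (by positivity)]; nlinarith)
  have hK0 := Real.log_nonneg (show 1 ≤ 1 / κ₀ ^ 2 by
    rw [le_div_iff₀ (by positivity)]; nlinarith)
  have hv0 := Real.log_nonneg (show 1 ≤ 1 + v by linarith)
  have hL0 := Real.log_nonneg (show 1 ≤ 1 + L by linarith)
  have hZ0 := Real.log_nonneg hZ
  refine le_trans ?_ hN
  simp only [softO, pow_one]
  set l := Real.log (1 / ε)
  set lv := Real.log (1 + v)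
  set lZ := Real.log Z
  set lb := Real.log (1 / (1 - γ) ^ 2)
  set lq := Real.log (n / g ^ 2)
  set lK := Real.log (1 / κ₀ ^ 2)
  set lL := Real.log (1 + L)
  have hl0 : 0 ≤ l := by linarith
  set W := 32002 * (4 * n * (1 + L) * (1 + lq) * (1 + lK)) * (1 / (1 - γ)) ^ 2 /
    (ε ^ 2 * (g * κ₀) ^ 2) * (9 * l * (1 + lv) * (1 + lZ) * (1 + lb)) with hW
  have hW0 : 0 ≤ W := by positivity
  -- Pure slack: the argument needs one power of `log (1/ε)` and only a logarithm of `Z`.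
  have hfac : 1 ≤ 2 * l * Z * (1 + lL) :=
    one_le_mul_of_one_le_of_one_le (one_le_mul_of_one_le_of_one_le hl hZ) (by linarith)
  calc _ ≤ W := by
        rw [hW]
        gcongr
    _ ≤ W * (2 * l * Z * (1 + lL)) := le_mul_of_one_le_right hW0 hfac
    _ = _ := by
        rw [hW]
        field_simp
        ring

theorem balanced_bound_le {ε μ τ b α U X i : ℝ} (hε : 0 < ε) (hμ : 0 < μ) (hτ : 0 < τ)
    (hb : 0 < b) (hα : α = ε ^ 2 * μ / (4000 * τ * b ^ 2))
    (hi : 32000 * (τ * b ^ 2 / (ε ^ 2 * μ ^ 2) * U) ≤ i)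
    (hX : 8 * X ^ 2 / ε ^ 2 ≤ Real.exp U) :
    4 * Real.exp (-(α * μ / 8 * i)) * X ^ 2 + 1609 * (α * τ) / μ * b ^ 2 ≤ ε ^ 2 := by
  have hα0 : 0 < α := by rw [hα]; positivity
  have hexp : Real.exp (-(α * μ / 8 * i)) ≤ Real.exp (-U) := by
    rw [Real.exp_le_exp, neg_le_neg_iff]
    calc U = α * μ / 8 * (32000 * (τ * b ^ 2 / (ε ^ 2 * μ ^ 2) * U)) := by
          rw [hα]
          field_simp
          ring
      _ ≤ α * μ / 8 * i := by gcongr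
  have h1 : 4 * Real.exp (-(α * μ / 8 * i)) * X ^ 2 ≤ ε ^ 2 / 2 := by
    calc 4 * Real.exp (-(α * μ / 8 * i)) * X ^ 2 ≤ 4 * Real.exp (-U) * X ^ 2 := by gcongr
      _ = ε ^ 2 / 2 * (8 * X ^ 2 / ε ^ 2) * Real.exp (-U) := by
        field_simp
        ring
      _ ≤ ε ^ 2 / 2 * Real.exp U * Real.exp (-U) := by gcongr
      _ = ε ^ 2 / 2 := by rw [mul_assoc, ← Real.exp_add, add_neg_cancel, Real.exp_zero, mul_one]
  have h2 : 1609 * (α * τ) / μ * b ^ 2 = 1609 / 4000 * ε ^ 2 := by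
    rw [hα]
    field_simp
  linarith [sq_nonneg ε]

theorem stepsize_bounds {ε μ τ b α : ℝ} (hε : 0 < ε) (hε2 : ε ≤ 1 / 2) (hμ : 0 < μ)
    (hμ1 : μ ≤ 1) (hτ : 1 ≤ τ) (hb : 1 ≤ b) (hα : α = ε ^ 2 * μ / (4000 * τ * b ^ 2)) :
    0 < α ∧ α < 1 ∧ 400 * (α * τ) ≤ μ := by
  have hα0 : 0 < α := by rw [hα]; positivity
  have hατ : α * τ * b ^ 2 = ε ^ 2 * μ / 4000 := by
    rw [hα]
    field_simp
  have h1 : α * τ ≤ α * τ * b ^ 2 := le_mul_of_one_le_right (by positivity) (one_le_pow₀ hb)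
  have h2 : ε ^ 2 * μ ≤ 1 * μ := by
    gcongr
    nlinarith
  have h3 : α ≤ α * τ := le_mul_of_one_le_right hα0.le hτ
  exact ⟨hα0, by linarith, by linarith⟩

/-- Needed for the burn-in: with this factor at least `1`, the window `τ` is itself covered by the
sample count. -/
theorem log_factor_ge_one {γ ε v Z : ℝ} (hγ0 : 0 ≤ γ) (hγ : γ < 1) (hε : 0 < ε)
    (hε2 : ε ≤ 1 / 2) (hv : 0 ≤ v) (hZ : 1 ≤ Z) :
    1 ≤ 9 * Real.log (1 / ε) * (1 + Real.log (1 + v)) * (1 + Real.log Z) *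
      (1 + Real.log (1 / (1 - γ) ^ 2)) := by
  have hγ' : 0 < 1 - γ := by linarith
  have h2 : Real.log 2 ≤ Real.log (1 / ε) :=
    Real.log_le_log (by norm_num) (by rw [le_div_iff₀ hε]; linarith)
  have h3 := Real.log_two_gt_d9
  have h4 := Real.log_nonneg (show 1 ≤ 1 + v by linarith)
  have h5 := Real.log_nonneg hZ
  have h6 := Real.log_nonneg (show 1 ≤ 1 / (1 - γ) ^ 2 by
    rw [le_div_iff₀ (by positivity)]; nlinarith)
  exact one_le_mul_of_one_le_of_one_le (one_le_mul_of_one_le_of_one_le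
    (one_le_mul_of_one_le_of_one_le (by linarith) (by linarith)) (by linarith)) (by linarith)

end SampleCount

/-- The expected error of `n`-step TD for the stepsize balancing bias and noise. -/
theorem MDP.integral_norm_tdDeviation_le {S A : Type*} [Fintype S] [DecidableEq S]
    [MeasurableSpace S] [DiscreteMeasurableSpace S] [Fintype A] [MeasurableSpace A]
    [DiscreteMeasurableSpace A] (M : MDP S A) (π : S → PMF A) (ν : PMF S) {n : ℕ} {α : ℝ}
    (V₀ : EuclideanSpace ℝ S) {κ : S → ℝ}
    (hκ : IsStationaryDist (M.transMatrix π) κ) {κ₀ μ b : ℝ} (hκ₀ : ∀ s, κ₀ ≤ κ s)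
    (hμ : μ = (1 - M.γ ^ n) * κ₀) (hμ0 : 0 < μ) (hμ1 : μ ≤ 1) {t : ℕ}
    (ht : ∀ s, tvDist ((M.transMatrix π ^ t) s) κ ≤ μ / 8) (hn : 1 ≤ n) {τ : ℕ}
    (hτ : τ = n + t) {ε : ℝ} (hε : 0 < ε) (hε2 : ε ≤ 1 / 2) (hb : b = 1 / (1 - M.γ)) (hb1 : 1 ≤ b)
    (hα : α = ε ^ 2 * μ / (4000 * τ * b ^ 2)) {U : ℝ} (hU1 : 1 ≤ U)
    (hU : 8 * ‖V₀ - M.valueFunction π‖ ^ 2 / ε ^ 2 ≤ Real.exp U) {k : ℕ}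
    (hk : 32002 * τ * b ^ 2 / (ε ^ 2 * μ ^ 2) * U ≤ k + n) :
    ∫ ω, ‖M.tdDeviation π n α V₀ ω k‖ ∂(M.pathMeasure π ν) ≤ ε := by
  have hτ1 : (1 : ℝ) ≤ τ := by exact_mod_cast (show 1 ≤ τ by omega)
  obtain ⟨hα0, hα1, hατ⟩ := stepsize_bounds hε hε2 hμ0 hμ1 hτ1 hb1 hα
  refine integral_le_of_integral_sq_le (M.integrable_comp_tdDeviation π ν V₀ n α k fun x => ‖x‖)
    (M.integrable_comp_tdDeviation π ν V₀ n α k fun x => ‖x‖ ^ 2) hε ?_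
  set D := τ * b ^ 2 / (ε ^ 2 * μ ^ 2) with hD
  have hDτ : (τ : ℝ) ≤ D := by
    rw [hD, le_div_iff₀ (by positivity)]
    have hεμ : ε ^ 2 * μ ^ 2 ≤ 1 :=
      mul_le_one₀ (by nlinarith) (by positivity) (pow_le_one₀ hμ0.le hμ1)
    exact mul_le_mul_of_nonneg_left (hεμ.trans (one_le_pow₀ hb1)) (by positivity)
  have hcount : 32002 * (D * U) ≤ k + n := by
    refine le_trans (le_of_eq ?_) hk
    rw [hD]
    ring
  have hDU : (τ : ℝ) ≤ D * U := hDτ.trans (le_mul_of_one_le_right (by positivity) hU1)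
  have hnτ : (n : ℝ) ≤ τ := by exact_mod_cast (show n ≤ τ by omega)
  -- The constant `32002 = 32000 + 2` pays for the burn-in `τ` and for the `n ≤ τ` look-ahead
  -- samples.
  have hkτ : τ ≤ k := by
    have : (τ : ℝ) ≤ k := by linarith
    exact_mod_cast this
  obtain ⟨i, rfl⟩ := Nat.exists_eq_add_of_le hkτ
  have hi : 32000 * (D * U) ≤ i := by
    push_cast at hcount
    linarith
  have hbound := M.integral_norm_sq_tdDeviation_add_le π ν V₀ hκ hκ₀ hμ hμ0 hμ1 ht hn hα0
    hα1.le hτ hατ i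
  rw [← hb] at hbound
  exact hbound.trans (balanced_bound_le hε hμ0 (by linarith) (by linarith) hα hi hU)

theorem mainTheorem12 :
    ∃ (c : ℝ) (p : ℕ), 0 < c ∧
      ∀ (S A : Type*) [Fintype S] [DecidableEq S] [MeasurableSpace S] [DiscreteMeasurableSpace S]
        [Fintype A] [MeasurableSpace A] [DiscreteMeasurableSpace A]
        (M : MDP S A) (π : S → PMF A) (κ : S → ℝ),
        (M.transMatrix π).IsIrreducible →
        IsAperiodicChain (M.transMatrix π) →
        IsStationaryDist (M.transMatrix π) κ →
        (∃ L : ℝ, MixesWithConstant (M.transMatrix π) κ L) ∧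
        ∀ L : ℝ, MixesWithConstant (M.transMatrix π) κ L →
        ∀ n : ℕ, 1 ≤ n → ∀ ε : ℝ, 0 < ε → ε ≤ 1 / 2 →
        ∃ α : ℝ, 0 < α ∧ α < 1 ∧
        ∀ (ν : PMF S) (V₀ : EuclideanSpace ℝ S) (k : ℕ),
          c * (Real.log (1 / ε) ^ 2 / ε ^ 2)
              * softO p (1 / (1 - M.γ) ^ 2)
              * softO p (n / (1 - M.γ ^ n) ^ 2)
              * softO p (1 / (⨅ s, κ s) ^ 2)
              * softO p (Real.sqrt (Fintype.card S))
              * softO p (1 + L)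
              * (1 + Real.log (1 + ‖V₀‖)) ^ p ≤ (k : ℝ) + n →
          Integrable
            (fun ω => ‖M.nStepTD n (fun _ => α) V₀ ω k - M.valueFunction π‖)
            (M.pathMeasure π ν) ∧
          ∫ ω, ‖M.nStepTD n (fun _ => α) V₀ ω k - M.valueFunction π‖ ∂(M.pathMeasure π ν) ≤ ε := by
  -- `2304144 = 32002 · 4 · 9 · 2`: sample count, mixing window, logarithm of the initial error, and
  -- the slack `2 log (1/ε) ≥ 1`.
  refine ⟨2304144, 1, by norm_num, ?_⟩
  intro S A _ _ _ _ _ _ _ M π κ hirr hap hκ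
  have hP := M.transMatrix_mem_rowStochastic π
  refine ⟨exists_mixesWithConstant hP hirr hap hκ, ?_⟩
  intro L hL n hn ε hε hε2
  have hne := hκ.nonempty
  obtain ⟨s₀, hs₀⟩ := exists_eq_ciInf_of_finite (f := κ)
  generalize hκ₀d : ⨅ s, κ s = κ₀ at *
  have hκ₀ : ∀ s, κ₀ ≤ κ s := fun s => hκ₀d ▸ ciInf_le (Set.finite_range κ).bddBelow s
  have hκ₀0 : 0 < κ₀ := hs₀ ▸ hκ.pos hP hirr s₀
  have hκ₀1 : κ₀ ≤ 1 := hs₀ ▸ hκ.le_one s₀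
  obtain ⟨g, hg⟩ : ∃ g, g = 1 - M.γ ^ n := ⟨_, rfl⟩
  have hg0 : 0 < g := hg ▸ sub_pos.2 (pow_lt_one₀ M.γ_pos.le M.γ_lt_one (by omega))
  have hg1 : g ≤ 1 := by linarith [pow_nonneg M.γ_pos.le n]
  -- Mixing at precision `1/2` already forces this, since the mixing time is a natural number.
  have hL0 : 0 ≤ L := by
    obtain ⟨k, hk, -⟩ := hL (1 / 2) (by norm_num) (by norm_num)
    by_contra! hneg
    have : 0 < Real.log (1 / (1 / 2)) + 1 := by
      have := Real.log_pos (show (1 : ℝ) < 1 / (1 / 2) by norm_num)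
      linarith
    have := mul_neg_of_neg_of_pos hneg this
    have := Nat.cast_nonneg (α := ℝ) k
    linarith
  have hμ0 : 0 < g * κ₀ := mul_pos hg0 hκ₀0
  have hμ1 : g * κ₀ ≤ 1 := mul_le_one₀ hg1 hκ₀0.le hκ₀1
  -- The precision involves neither `ε` nor `V₀`, so the stepsize below is independent of `ν`, `V₀`
  -- and `k`.
  obtain ⟨t, ht, htv⟩ := hL (g * κ₀ / 8) (by positivity) (by linarith)
  have hb : 1 ≤ 1 / (1 - M.γ) := by
    rw [le_div_iff₀ (by linarith [M.γ_lt_one])]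
    linarith [M.γ_pos]
  have hτ1 : (1 : ℝ) ≤ ((n + t : ℕ) : ℝ) := by exact_mod_cast (show 1 ≤ n + t by omega)
  obtain ⟨α, hα⟩ : ∃ α : ℝ, α =
    ε ^ 2 * (g * κ₀) / (4000 * ((n + t : ℕ) : ℝ) * (1 / (1 - M.γ)) ^ 2) := ⟨_, rfl⟩
  obtain ⟨hα0, hα1, -⟩ := stepsize_bounds hε hε2 hμ0 hμ1 hτ1 hb hα
  refine ⟨α, hα0, hα1, fun ν V₀ k hk => ?_⟩
  rw [← hg] at hk
  refine ⟨M.integrable_comp_tdDeviation π ν V₀ n α k fun x => ‖x‖, ?_⟩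
  have hZ : 1 ≤ Real.sqrt (Fintype.card S) := by
    rw [Real.one_le_sqrt]
    exact_mod_cast Fintype.card_pos
  have hcount := sample_count_ge hn M.γ_pos.le M.γ_lt_one hg0 hg1 hκ₀0 hκ₀1 hL0 hε hε2
    (norm_nonneg V₀) hZ (mixing_window_le hn hg0 hg1 hκ₀0 hκ₀1 hL0 ht) hk
  have hinit := initial_error_le M.γ_pos.le M.γ_lt_one hε hε2 (norm_nonneg V₀) hZ
    (norm_nonneg (V₀ - M.valueFunction π))
    ((norm_sub_le _ _).trans (by linarith [M.norm_valueFunction_le π]))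
  exact M.integral_norm_tdDeviation_le π ν V₀ hκ hκ₀ (by rw [hg]) hμ0 hμ1 htv hn rfl hε hε2 rfl hb
    hα (log_factor_ge_one M.γ_pos.le M.γ_lt_one hε hε2 (norm_nonneg V₀) hZ) hinit hcount
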